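/- Let $F$ be a field and let $\mathfrak g=\langle x\rangle\ltimes\mathfrak a$ be a finite dimensional Lie algebra over $F$, where $x\neq 0$, $\mathfrak a$ is an abelian ideal and $\operatorname{ad}x$ acts diagonalizably on $\mathfrak a$. Let $\mathfrak a_0$ be the $0$-eigenspace of $\operatorname{ad}x$ in $\mathfrak a$ and let $\mathfrak n=[\mathfrak g,\mathfrak r]$, where $\mathfrak r$ is the solvable radical of $\mathfrak g$ (so here $\mathfrak n=[\mathfrak g,\mathfrak g]$). Suppose that $F$ is an infinite perfect field or $\mathfrak a_0=0$. For a finite dimensional $\mathfrak g$-module $U$ define its nilpotency series by $U^{(0)}=0$ and $U^{(i)}/U^{(i-1)}=\{w\in U/U^{(i-1)} : \mathfrak n w=0\}$ for $i\ge 1$; the least $m$ with $U^{(m)}=U$, if there is one, is the nilpotency length of $U$. A module is uniserial if its submodules form a chain. The module $U$ is linked if $U\neq 0$, every element of $\mathfrak n$ acts nilpotently on $U$, and every factor $U^{(i)}/U^{(i-1)}$ is a uniserial $\mathfrak g/\mathfrak n$-module. Let $U$ be a faithful linked $\mathfrak g$-module of nilpotency length $m>1$. Call $y\in(\langle x\rangle\oplus\mathfrak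 a_0)\setminus\mathfrak a_0$, together with monic irreducible polynomials $p_1,\dots,p_m\in F[X]$ and natural numbers $s_1\ge\cdots\ge s_m$, adapted to $U$ if, with $X$ acting as $y$, the factors $U^{(i)}/U^{(i-1)}$ are uniserial $F[X]$-modules isomorphic to $F[X]/(p_i^{s_i})$, and $p_i(X)=p_1(X+i-1)$, for $1\le i\le m$. Then adapted data $y,(p_i),(s_i)$ exist. Moreover, let $y,(p_i),(s_i)$ be any adapted data, put $d=\deg p_1$, $\mathfrak a(\delta)=\{u\in\mathfrak a : [y,u]=\delta u\}$ for $\delta\in F$, and $S=\{\delta\in F : \mathfrak a(\delta)U\neq 0\}$. Assume that, if $F$ has prime characteristic $q$, then $q\ge m$ and the only $\gamma\in F$ with $p_1(X+\gamma)=p_1(X)$ is $\gamma=0$. Then the following hold. (a) Every eigenvalue of $\operatorname{ad}y$ on $\mathfrak a$ is (the image in $F$ of) an integer $j$ with $0\le j<m$, and $\dim\mathfrak a(j)\le d\,s_{j+1}$ for each such $j$. (b) Suppose in addition that $U$ is uniserial. If $F$ is algebraically closed, then $p_1=X-\alpha$ for some $\alpha\in F$. Whenever $p_1=X-\alpha$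 with $\alpha\in F$, the following hold. All eigenvalues of $\operatorname{ad}y$ on $\mathfrak a$ have multiplicity $1$, and $1\in S$. There are a basis of $U$ (with $m$ elements) and a nonzero $v\in\mathfrak n$ with $[y,v]=v$ such that, relative to this basis, $y$ is represented by $\operatorname{diag}(\alpha,\alpha-1,\dots,\alpha-(m-1))$ and $v$ by the $m\times m$ matrix $N$ with ones on the first superdiagonal and zeros elsewhere. If $(v_j)_{j\in S}$ is any basis of $\mathfrak a$ with $[y,v_j]=jv_j$ for all $j\in S$ and $v_1=v$, then relative to the same basis of $U$ every $v_j$ is represented by $\beta_jN^j$, where $0\neq\beta_j\in F$ and $\beta_1=1$ (here $j\in S$ is identified with the integer in $[0,m)$ that it comes from). (c) In the situation of (b), the isomorphism type of $U$ is uniquely determined by $m$, $\alpha$ and $(\beta_j)_{j\in S}$, and determines them. That is, let $U'$ be a $\mathfrak g$-module having a basis with $m'$ elements relative to which $y$ is represented by $\operatorname{diag}(\alpha',\alpha'-1,\dots,\alpha'-(m'-1))$ and every $v_j$, $j\in S$, by $\beta'_jN^{k}$, where $N$ is the $m'\times m'$ nilpotent shift, $k$ is an integer with $0\le k<m'$ and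 image $j$ in $F$, $\beta'_j\in F$, and $\beta'_1=1$. Then $U\cong U'$ if and only if $m=m'$, $\alpha=\alpha'$ and $\beta_j=\beta'_j$ for all $j\in S$. -/

import Mathlib

namespace LinkedModules

open Polynomial

section Modules

variable (F : Type*) [Field F] (L : Type*) [LieRing L] [LieAlgebra F L]

/-- The ideal `𝔫 = [𝔤, 𝔯]`, where `𝔯` is the solvable radical of `𝔤`. -/
noncomputable def nilRad : LieIdeal F L :=
  ⁅(⊤ : LieIdeal F L), LieAlgebra.radical F L⁆

variable (U : Type*) [AddCommGroup U] [Module F U] [LieRingModule L U] [LieModule F L U]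

/-- For a submodule `N` of `U`, the submodule `N'` containing `N` such that `N' / N` is the
`0`-weight space of `𝔫` in `U / N`. -/
noncomputable def nilpStep (N : LieSubmodule F L U) : LieSubmodule F L U where
  carrier := {u | ∀ v ∈ nilRad F L, ⁅v, u⁆ ∈ N}
  add_mem' := fun {u w} hu hw v hv => by
    rw [lie_add]; exact N.add_mem (hu v hv) (hw v hv)
  zero_mem' := fun v _ => by rw [lie_zero]; exact N.zero_mem
  smul_mem' := fun c u hu v hv => by
    rw [lie_smul]; exact N.smul_mem c (hu v hv)
  lie_mem := fun {z u} hu v hv => by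
    rw [leibniz_lie]
    exact N.add_mem (hu _ (lie_mem_left F L _ _ _ hv)) (N.lie_mem (hu v hv))

/-- The nilpotency series `0 = U⁽⁰⁾ ⊆ U⁽¹⁾ ⊆ ⋯` of `U`. -/
noncomputable def nilpSeries : ℕ → LieSubmodule F L U
  | 0 => ⊥
  | i + 1 => nilpStep F L U (nilpSeries i)

/-- The `i`-th nilpotency factor of `U`, counted from `0`: the module `U⁽ⁱ⁺¹⁾ / U⁽ⁱ⁾`. -/
abbrev NilpFactor (i : ℕ) : Type _ :=
  (nilpSeries F L U (i + 1)) ⧸ ((nilpSeries F L U i).comap (nilpSeries F L U (i + 1)).incl)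

/-- `U` is uniserial: its submodules form a chain. -/
def IsUniserial : Prop :=
  ∀ N N' : LieSubmodule F L U, N ≤ N' ∨ N' ≤ N

/-- `U` is admissible: it is nonzero and `𝔫` acts on it via nilpotent operators. -/
structure IsAdmissible : Prop where
  nontrivial : Nontrivial U
  nilpotent : ∀ v ∈ nilRad F L, IsNilpotent (LieModule.toEnd F L U v)

/-- `m` is the nilpotency length of `U`. -/
def IsNilpLength (m : ℕ) : Prop :=
  IsLeast {i : ℕ | nilpSeries F L U i = ⊤} m

/-- `U` is linked: it is admissible and all its nilpotency factors are uniserial. (As `𝔫` acts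
trivially on a nilpotency factor, its `𝔤`-submodules are its `𝔤/𝔫`-submodules.) -/
structure IsLinked : Prop where
  admissible : IsAdmissible F L U
  uniserial : ∀ i : ℕ, IsUniserial F L (NilpFactor F L U i)

end Modules

section Algebra

variable {F : Type*} [Field F] {L : Type*} [LieRing L] [LieAlgebra F L]

/-- `𝔞(δ) = {u ∈ 𝔞 | [y, u] = δ u}`. -/
def adEigenspace (y : L) (a : LieIdeal F L) (δ : F) : Submodule F L :=
  a.toSubmodule ⊓ Module.End.eigenspace (LieAlgebra.ad F L y) δ

/-- `𝔤 = ⟨x⟩ ⋉ 𝔞`, where `ad x` acts diagonalizably on the abelian ideal `𝔞`. -/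
structure IsDiagSemidirect (x : L) (a : LieIdeal F L) : Prop where
  ne_zero : x ≠ 0
  isCompl : IsCompl (Submodule.span F {x}) a.toSubmodule
  abelian : IsLieAbelian a
  diagonalizable : a.toSubmodule = ⨆ δ : F, adEigenspace x a δ

/-- The set `S` of all `δ ∈ F` such that `𝔞(δ) U ≠ 0`. -/
def actingEigenvalues (y : L) (a : LieIdeal F L) (U : Type*) [AddCommGroup U] [Module F U]
    [LieRingModule L U] [LieModule F L U] : Set F :=
  {δ | ∃ u ∈ adEigenspace y a δ, ∃ w : U, ⁅u, w⁆ ≠ 0}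

/-- The `F[X]`-module structure on the `i`-th nilpotency factor of `U` (counted from `0`) in which
`X` acts as `y`. -/
abbrev FactorAEval (F : Type*) [Field F] {L : Type*} [LieRing L] [LieAlgebra F L]
    (U : Type*) [AddCommGroup U] [Module F U]
    [LieRingModule L U] [LieModule F L U] (y : L) (i : ℕ) : Type _ :=
  Module.AEval' (LieModule.toEnd F L (NilpFactor F L U i) y)

/-- The element `y` lies in `(⟨x⟩ ⊕ 𝔞₀) \ 𝔞₀`, the `m` nilpotency factors of `U` are uniserial
`F[X]`-modules via `y`, isomorphic to `F[X]/(p₁^s₁), …, F[X]/(pₘ^sₘ)` with the `pᵢ` monic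
irreducible, `pᵢ(X) = p₁(X + i - 1)` and `s₁ ≥ ⋯ ≥ sₘ`. Here `pᵢ` and `sᵢ` are `p (i - 1)` and
`s (i - 1)`; values of `p` and `s` at indices `≥ m` are irrelevant. -/
structure IsAdapted (x : L) (a : LieIdeal F L) (U : Type*) [AddCommGroup U] [Module F U]
    [LieRingModule L U] [LieModule F L U] (m : ℕ) (y : L) (p : ℕ → F[X]) (s : ℕ → ℕ) : Prop where
  mem : y ∈ Submodule.span F {x} ⊔ adEigenspace x a 0
  notMem : y ∉ adEigenspace x a 0
  uniserial : ∀ i < m, ∀ N N' : Submodule F[X] (FactorAEval F U y i), N ≤ N' ∨ N' ≤ N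
  monic : ∀ i < m, (p i).Monic
  irreducible : ∀ i < m, Irreducible (p i)
  factor : ∀ i < m,
    Nonempty (FactorAEval F U y i ≃ₗ[F[X]] (F[X] ⧸ Ideal.span {p i ^ s i}))
  shift : ∀ i < m, p i = (p 0).comp (X + C (i : F))
  antitone : ∀ i j : ℕ, i ≤ j → j < m → s j ≤ s i

/-- The `m × m` nilpotent matrix with ones on the first superdiagonal and zeros elsewhere. -/
def shiftMatrix (F : Type*) [Field F] (m : ℕ) : Matrix (Fin m) (Fin m) F :=
  Matrix.of fun i j => if (j : ℕ) = (i : ℕ) + 1 then 1 else 0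

/-- The diagonal matrix `diag(α, α - 1, …, α - (m - 1))`. -/
def descMatrix (m : ℕ) (α : F) : Matrix (Fin m) (Fin m) F :=
  Matrix.diagonal fun i => α - ((i : ℕ) : F)

/-- Relative to the basis `b` of `U`, the element `y` is represented by
`diag(α, α - 1, …, α - (m - 1))` and every `w δ`, `δ ∈ S`, is represented by `β δ • N ^ j`, where
`N` is the nilpotent shift and `δ` is the image in `F` of the integer `j`, `0 ≤ j < m`. -/
structure IsNormalBasis {S : Set F} (y : L) (w : S → L) {U : Type*} [AddCommGroup U] [Module F U]
    [LieRingModule L U] [LieModule F L U] {m : ℕ} (b : Module.Basis (Fin m) F U)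
    (α : F) (β : S → F) : Prop where
  diag : LinearMap.toMatrix b b (LieModule.toEnd F L U y) = descMatrix m α
  shift : ∀ δ : S, ∃ j : ℕ, j < m ∧ (δ : F) = (j : F) ∧
    LinearMap.toMatrix b b (LieModule.toEnd F L U (w δ)) = β δ • shiftMatrix F m ^ j

end Algebra

end LinkedModules

/-!
Throughout, `𝔫 = [𝔤, 𝔤]` is spanned by the `ad x`-eigenvectors of `𝔞` with nonzero eigenvalue
("weight vectors"), and `𝔤 = ⟨x⟩ ⊕ 𝔞₀ ⊕ 𝔫` with `⟨x⟩ ⊕ 𝔞₀` abelian. Two facts are used everywhere.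
If `[y, v] = δ v`, then `v q(y) = q(y - δ) v` for every polynomial `q` (`lie_aeval_toEnd`), so that a
weight vector acting nontrivially between a `p`-primary and a `q`-primary part forces
`q = p(X - δ)` (`comp_eq_of_lie_notMem`). And since `𝔞` is abelian, an element of `𝔞` sending
`U⁽ⁱ⁾` into `U⁽ʲ⁾` sends `U⁽ⁱ⁺¹⁾` into `U⁽ʲ⁺¹⁾` (`IsDiagSemidirect.lie_mem_succ`).

*Existence of adapted data.* On a nilpotency factor, `⟨x⟩ ⊕ 𝔞₀` generates a commutative algebra
acting faithfully on a uniserial module, hence a chain ring `A`. Over a perfect field, `F[y] = A`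
as soon as `y` generates the residue field and is not semisimple modulo the square of the maximal
ideal, which excludes finitely many proper subspaces only (`exists_finite_forall_adjoin_eq_top`);
an infinite field leaves room for a `y` that works for all factors at once. Each factor is then
uniserial over `F[y]`, hence `F[X]/(pˢ)`. A weight vector acting nontrivially between the two
topmost factors acts nontrivially between all consecutive ones
(`IsDiagSemidirect.exists_weight_forall`), so after rescaling `y` all shifts are equal to `1`;
and `U⁽ⁱ⁺²⁾/U⁽ⁱ⁺¹⁾` embeds into the maps from `𝔫` to `U⁽ⁱ⁺¹⁾/U⁽ⁱ⁾`, which makes the exponents decrease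
(`IsDiagSemidirect.factor_succ`).

*Weights of `𝔞`.* If `w ∈ 𝔞(δ)` kills `U⁽ⁱ⁾` but not `U⁽ⁱ⁺¹⁾`, it maps `U⁽ⁱ⁺¹⁾` into `U⁽¹⁾`, and
comparing `p(X + i)` with `p` gives `δ = i` (`IsFactorSystem.weight_eq`). Consequently `w ∈ 𝔞(j)`
is determined by its value on a generator of `U⁽ʲ⁺¹⁾` modulo `U⁽ʲ⁾`, a vector of `U⁽¹⁾` killed by
`p(y) ^ s j`, which bounds `dim 𝔞(j)` (`IsFactorSystem.finrank_le`).

*The uniserial case.* If `p = X - α`, the eigenvectors of `y` in `U⁽²⁾` for `α - 1` and in `U⁽¹⁾` for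
`α` span a submodule not contained in `U⁽¹⁾`; by uniseriality it contains `U⁽¹⁾`, so `y` is a scalar
there and all exponents are `1` (`IsFactorSystem.lie_eq_smul`). Applying a vector `v` of weight `1`
repeatedly to a `y`-eigenvector outside `U⁽ᵐ⁻¹⁾` yields the basis in which `y` is diagonal and `v`
is the shift; everything in `𝔞(j)` commutes with `v` and hence is a multiple of `v ^ j`. In a module
with such a basis `α` is the eigenvalue of `y` on the line `ker v`, so the parameters are invariants.
-/

namespace LinkedModules

open Polynomial

/-! ### Operators and polynomials -/

section Operators

variable {F : Type*} [Field F] {M M' : Type*} [AddCommGroup M] [Module F M]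
  [AddCommGroup M'] [Module F M']

theorem map_aeval_of_intertwines {T : Module.End F M} {T' : Module.End F M'} (f : M →ₗ[F] M')
    (h : ∀ u, f (T u) = T' (f u)) (q : F[X]) (u : M) :
    f (aeval T q u) = aeval T' q (f u) := by
  induction q using Polynomial.induction_on' generalizing u with
  | add p q hp hq => simp [hp, hq]
  | monomial n a =>
    have key : ∀ n : ℕ, ∀ u, f ((T ^ n) u) = (T' ^ n) (f u) := by
      intro n
      induction n with
      | zero => simp
      | succ n ih => intro u; rw [pow_succ, pow_succ, Module.End.mul_apply, Module.End.mul_apply,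
          ih, h]
    simp [aeval_monomial, key, Module.algebraMap_end_apply]

theorem aeval_mem_of_invariant {T : Module.End F M} {N : Submodule F M}
    (hN : ∀ u ∈ N, T u ∈ N) (q : F[X]) {u : M} (hu : u ∈ N) : aeval T q u ∈ N := by
  have := map_aeval_of_intertwines (T := T.restrict hN) (T' := T) N.subtype (fun _ => rfl) q ⟨u, hu⟩
  rw [Submodule.subtype_apply, Submodule.subtype_apply] at this
  rw [← this]
  exact Subtype.property _

/-- A vector which two coprime polynomials in `T` send into a `T`-invariant subspace lies in that
subspace. -/
theorem mem_of_isCoprime {T : Module.End F M} {N : Submodule F M}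
    (hN : ∀ u ∈ N, T u ∈ N) {f h : F[X]} (hfh : IsCoprime f h) {u : M}
    (hf : aeval T f u ∈ N) (hh : aeval T h u ∈ N) : u ∈ N := by
  obtain ⟨r, t, hrt⟩ := hfh
  have : u = aeval T r (aeval T f u) + aeval T t (aeval T h u) := by
    rw [← Module.End.mul_apply, ← Module.End.mul_apply, ← map_mul, ← map_mul,
      ← LinearMap.add_apply, ← map_add, hrt]
    simp
  rw [this]
  exact N.add_mem (aeval_mem_of_invariant hN _ hf) (aeval_mem_of_invariant hN _ hh)

/-- Two monic irreducible polynomials with non-coprime powers are equal. -/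
theorem eq_of_not_isCoprime_pow {p q : F[X]} (hp : Irreducible p) (hq : Irreducible q)
    (hpm : p.Monic) (hqm : q.Monic) {k l : ℕ} (h : ¬ IsCoprime (p ^ k) (q ^ l)) : p = q := by
  by_contra hne
  apply h
  apply IsCoprime.pow
  rw [hp.coprime_iff_not_dvd]
  intro hd
  exact hne (eq_of_monic_of_associated hpm hqm (hp.associated_of_dvd hq hd))

theorem comp_X_add_C_comp (p : F[X]) (γ δ : F) :
    (p.comp (X + C γ)).comp (X + C δ) = p.comp (X + C (γ + δ)) := by
  rw [comp_assoc]
  congr 1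
  simp only [add_comp, X_comp, C_comp, C_add]
  ring

theorem monic_comp_X_add_C {p : F[X]} (hp : p.Monic) (γ : F) : (p.comp (X + C γ)).Monic :=
  hp.comp_X_add_C γ

theorem irreducible_comp_X_add_C {p : F[X]} (hp : Irreducible p) (γ : F) :
    Irreducible (p.comp (X + C γ)) := by
  have : p.comp (X + C γ) = Polynomial.taylorEquiv γ p := rfl
  rw [this]
  exact (MulEquiv.irreducible_iff (Polynomial.taylorEquiv γ)).mpr hp

/-- In characteristic zero a nonconstant polynomial has no nontrivial translation symmetry. -/
theorem eq_zero_of_comp_X_add_C_eq [CharZero F] {p : F[X]} (hp : 0 < p.natDegree) {γ : F}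
    (h : p.comp (X + C γ) = p) : γ = 0 := by
  by_contra hγ
  have key : ∀ n : ℕ, p.eval ((n : F) * γ) = p.eval 0 := by
    intro n
    induction n with
    | zero => simp
    | succ n ih =>
      rw [← ih]
      conv_rhs => rw [← h]
      simp [eval_comp, add_mul]
  -- `p` takes the value `p(0)` at all multiples of `γ`, so it is constant
  have h0 : p - C (p.eval 0) = 0 := by
    apply Polynomial.eq_zero_of_infinite_isRoot
    apply Set.infinite_of_injective_forall_mem (f := fun n : ℕ => (n : F) * γ)
    · intro a b hab
      simpa [hγ] using hab
    · intro n
      simp [IsRoot, key n]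
  rw [sub_eq_zero.mp h0] at hp
  simp at hp

end Operators

/-! ### The Lie algebra -/

section LieStructure

variable {F : Type*} [Field F] {L : Type*} [LieRing L] [LieAlgebra F L]

theorem mem_adEigenspace {y : L} {a : LieIdeal F L} {δ : F} {u : L} :
    u ∈ adEigenspace y a δ ↔ u ∈ a ∧ ⁅y, u⁆ = δ • u := by
  simp [adEigenspace, Submodule.mem_inf]

variable {x : L} {a : LieIdeal F L}

theorem IsDiagSemidirect.lie_eq_zero (h : IsDiagSemidirect x a) {u w : L} (hu : u ∈ a)
    (hw : w ∈ a) : ⁅u, w⁆ = 0 := by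
  have := h.abelian
  have h0 : ⁅(⟨u, hu⟩ : a), (⟨w, hw⟩ : a)⁆ = 0 := trivial_lie_zero _ _ _ _
  simpa using congrArg Subtype.val h0

theorem IsDiagSemidirect.lie_lie_comm (h : IsDiagSemidirect x a) {U : Type*} [AddCommGroup U]
    [LieRingModule L U] {v w : L} (hv : v ∈ a) (hw : w ∈ a) (u : U) : ⁅v, ⁅w, u⁆⁆ = ⁅w, ⁅v, u⁆⁆ := by
  rw [leibniz_lie, h.lie_eq_zero hv hw, zero_lie, zero_add]

theorem IsDiagSemidirect.exists_eq (h : IsDiagSemidirect x a) (z : L) :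
    ∃ c : F, ∃ u ∈ a, z = c • x + u := by
  have : z ∈ Submodule.span F {x} ⊔ a.toSubmodule := by
    rw [h.isCompl.sup_eq_top]; trivial
  obtain ⟨w, hw, u, hu, rfl⟩ := Submodule.mem_sup.mp this
  obtain ⟨c, rfl⟩ := Submodule.mem_span_singleton.mp hw
  exact ⟨c, u, hu, rfl⟩

theorem IsDiagSemidirect.induction (h : IsDiagSemidirect x a) {P : L → Prop}
    (zero : P 0) (add : ∀ u w, P u → P w → P (u + w))
    (eigen : ∀ δ, ∀ u ∈ adEigenspace x a δ, P u) {u : L} (hu : u ∈ a) : P u := by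
  have hu' : u ∈ ⨆ δ : F, adEigenspace x a δ := by
    rw [← h.diagonalizable]; exact hu
  exact Submodule.iSup_induction _ (motive := P) hu' eigen zero add

theorem IsDiagSemidirect.isSolvable (h : IsDiagSemidirect x a) : LieAlgebra.IsSolvable L := by
  have h1 : LieAlgebra.derivedSeries F L 1 ≤ a := by
    rw [LieAlgebra.derivedSeries_def, LieAlgebra.derivedSeriesOfIdeal_succ,
      LieSubmodule.lieIdeal_oper_eq_span, LieSubmodule.lieSpan_le]
    rintro _ ⟨⟨z, -⟩, ⟨w, -⟩, rfl⟩
    obtain ⟨c, u, hu, rfl⟩ := h.exists_eq z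
    obtain ⟨d, t, ht, rfl⟩ := h.exists_eq w
    simp only [add_lie, lie_add, lie_smul, smul_lie, lie_self, smul_zero, zero_add,
      h.lie_eq_zero hu ht, add_zero, SetLike.mem_coe]
    rw [← lie_skew u x]
    exact a.add_mem (a.smul_mem _ (a.neg_mem (lie_mem_right F L a _ _ hu)))
      (a.smul_mem _ (lie_mem_right F L a _ _ ht))
  refine LieAlgebra.IsSolvable.mk (R := F) (k := 2) ?_
  rw [LieAlgebra.derivedSeries_def, LieAlgebra.derivedSeriesOfIdeal_succ,
    ← LieAlgebra.derivedSeries_def, eq_bot_iff, LieSubmodule.lieIdeal_oper_eq_span,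
    LieSubmodule.lieSpan_le]
  rintro _ ⟨⟨z, hz⟩, ⟨w, hw⟩, rfl⟩
  simp [h.lie_eq_zero (h1 hz) (h1 hw)]

theorem IsDiagSemidirect.nilRad_eq (h : IsDiagSemidirect x a) :
    nilRad F L = ⁅(⊤ : LieIdeal F L), (⊤ : LieIdeal F L)⁆ := by
  have := h.isSolvable
  have htop : LieAlgebra.radical F L = ⊤ :=
    top_le_iff.mp (le_sSup (show LieAlgebra.IsSolvable (⊤ : LieIdeal F L) from inferInstance))
  rw [nilRad, htop]

theorem IsDiagSemidirect.mem_nilRad (h : IsDiagSemidirect x a) {δ : F} (hδ : δ ≠ 0) {u : L}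
    (hu : u ∈ adEigenspace x a δ) : u ∈ nilRad F L := by
  have hx : ⁅x, δ⁻¹ • u⁆ = u := by
    rw [lie_smul, (mem_adEigenspace.mp hu).2, smul_smul, inv_mul_cancel₀ hδ, one_smul]
  rw [h.nilRad_eq, ← hx]
  exact LieSubmodule.lie_mem_lie trivial trivial

theorem IsDiagSemidirect.mem_span_weight (h : IsDiagSemidirect x a) {z : L}
    (hz : z ∈ nilRad F L) :
    z ∈ Submodule.span F {v : L | ∃ δ : F, δ ≠ 0 ∧ v ∈ adEigenspace x a δ} := by
  set W := Submodule.span F {v : L | ∃ δ : F, δ ≠ 0 ∧ v ∈ adEigenspace x a δ} with hW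
  have hx : ∀ u ∈ a, ⁅x, u⁆ ∈ W := by
    intro u hu
    refine h.induction (P := fun u => ⁅x, u⁆ ∈ W) ?_ ?_ ?_ hu
    · simp
    · intro u w h1 h2; rw [lie_add]; exact W.add_mem h1 h2
    · intro δ u hu
      rw [(mem_adEigenspace.mp hu).2]
      rcases eq_or_ne δ 0 with rfl | hδ
      · simp
      · exact W.smul_mem _ (Submodule.subset_span ⟨δ, hδ, hu⟩)
  rw [h.nilRad_eq, ← LieSubmodule.mem_toSubmodule,
    LieSubmodule.lieIdeal_oper_eq_linear_span'] at hz
  refine (Submodule.span_le.mpr ?_) hz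
  rintro _ ⟨z, -, w, -, rfl⟩
  obtain ⟨c, u, hu, rfl⟩ := h.exists_eq z
  obtain ⟨d, t, ht, rfl⟩ := h.exists_eq w
  simp only [add_lie, lie_add, lie_smul, smul_lie, lie_self, smul_zero, zero_add,
    h.lie_eq_zero hu ht, add_zero, SetLike.mem_coe]
  rw [← lie_skew u x]
  exact W.add_mem (W.smul_mem _ (W.neg_mem (hx _ hu))) (W.smul_mem _ (hx _ ht))

theorem IsDiagSemidirect.nilRad_le (h : IsDiagSemidirect x a) {z : L}
    (hz : z ∈ nilRad F L) : z ∈ a := by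
  refine (Submodule.span_le (p := a.toSubmodule).mpr ?_) (h.mem_span_weight hz)
  rintro v ⟨δ, -, hv⟩
  exact (mem_adEigenspace.mp hv).1

theorem exists_eq_smul_add_of_notMem {y : L}
    (hy : y ∈ Submodule.span F {x} ⊔ adEigenspace x a 0) (hy' : y ∉ adEigenspace x a 0) :
    ∃ c : F, c ≠ 0 ∧ ∃ w ∈ adEigenspace x a 0, y = c • x + w := by
  obtain ⟨w, hw, u, hu, rfl⟩ := Submodule.mem_sup.mp hy
  obtain ⟨c, rfl⟩ := Submodule.mem_span_singleton.mp hw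
  refine ⟨c, ?_, u, hu, rfl⟩
  rintro rfl
  apply hy'
  simpa using hu

theorem IsDiagSemidirect.adEigenspace_mul (h : IsDiagSemidirect x a) {c : F} (hc : c ≠ 0) {w : L}
    (hw : w ∈ adEigenspace x a 0) (δ : F) :
    adEigenspace (c • x + w) a (c * δ) = adEigenspace x a δ := by
  ext u
  rw [mem_adEigenspace, mem_adEigenspace]
  refine and_congr_right fun hu => ?_
  rw [add_lie, h.lie_eq_zero (mem_adEigenspace.mp hw).1 hu, add_zero, smul_lie, mul_smul]
  exact (smul_right_injective L hc).eq_iff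

/-- The element `x` of a decomposition `⟨x⟩ ⋉ 𝔞` may be replaced by any element of
`⟨x⟩ ⊕ 𝔞₀` outside `𝔞₀`. -/
theorem IsDiagSemidirect.replace (h : IsDiagSemidirect x a) {c : F} (hc : c ≠ 0) {w : L}
    (hw : w ∈ adEigenspace x a 0) : IsDiagSemidirect (c • x + w) a := by
  have hwa := (mem_adEigenspace.mp hw).1
  have hxa : ∀ d : F, d • x ∈ a → d = 0 := by
    intro d hd
    have h0 : d • x ∈ Submodule.span F {x} ⊓ a.toSubmodule :=
      ⟨Submodule.smul_mem _ _ (Submodule.mem_span_singleton_self x), hd⟩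
    rw [h.isCompl.inf_eq_bot, Submodule.mem_bot] at h0
    exact (smul_eq_zero.mp h0).resolve_right h.ne_zero
  have hdy : ∀ d : F, d • (c • x + w) ∈ a → d = 0 := by
    intro d hd
    rw [smul_add, smul_smul] at hd
    have := hxa _ ((Submodule.add_mem_iff_left _ (a.smul_mem d hwa)).mp hd)
    exact (mul_eq_zero.mp this).resolve_right hc
  refine ⟨?_, ?_, h.abelian, ?_⟩
  · intro h0
    have := hdy 1 (by rw [h0, smul_zero]; exact a.zero_mem)
    exact one_ne_zero this
  · refine IsCompl.of_eq ?_ ?_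
    · rw [eq_bot_iff]
      rintro z ⟨hz1, hz2⟩
      obtain ⟨d, rfl⟩ := Submodule.mem_span_singleton.mp hz1
      rw [hdy d hz2]; simp
    · rw [eq_top_iff]
      rintro z -
      obtain ⟨d, u, hu, rfl⟩ := h.exists_eq z
      have : d • x + u = (d * c⁻¹) • (c • x + w) + (u - (d * c⁻¹) • w) := by
        rw [smul_add, smul_smul, mul_assoc, inv_mul_cancel₀ hc, mul_one]; abel
      rw [this]
      exact Submodule.add_mem_sup
        (Submodule.smul_mem _ _ (Submodule.mem_span_singleton_self _))
        (a.sub_mem hu (a.smul_mem _ hwa))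
  · rw [h.diagonalizable]
    refine le_antisymm (iSup_le fun δ => ?_) (iSup_le fun δ => ?_)
    · rw [← h.adEigenspace_mul hc hw]
      exact le_iSup (adEigenspace (c • x + w) a) (c * δ)
    · have : δ = c * (c⁻¹ * δ) := by rw [mul_inv_cancel_left₀ hc]
      rw [this, h.adEigenspace_mul hc hw]
      exact le_iSup (adEigenspace x a) (c⁻¹ * δ)

end LieStructure

/-! ### The nilpotency series -/

section Series

variable {F : Type*} [Field F] {L : Type*} [LieRing L] [LieAlgebra F L]
  {U : Type*} [AddCommGroup U] [Module F U] [LieRingModule L U] [LieModule F L U]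

theorem nilpSeries_le_succ (i : ℕ) : nilpSeries F L U i ≤ nilpSeries F L U (i + 1) :=
  fun _ hu _ _ => (nilpSeries F L U i).lie_mem hu

theorem IsNilpLength.eq_top {m : ℕ} (h : IsNilpLength F L U m) : nilpSeries F L U m = ⊤ := h.1

theorem IsNilpLength.exists_notMem {m : ℕ} (h : IsNilpLength F L U m) {i : ℕ} (hi : i < m) :
    ∃ u ∈ nilpSeries F L U (i + 1), u ∉ nilpSeries F L U i := by
  by_contra! hcon
  have h1 : nilpSeries F L U (i + 1) = nilpSeries F L U i := le_antisymm hcon (nilpSeries_le_succ i)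
  have h2 : ∀ k, nilpSeries F L U (i + k) = nilpSeries F L U i := by
    intro k
    induction k with
    | zero => rfl
    | succ k ih =>
      rw [← h1]
      change nilpStep F L U (nilpSeries F L U (i + k)) = nilpStep F L U (nilpSeries F L U i)
      rw [ih]
  have h3 := h2 (m - i)
  rw [Nat.add_sub_cancel' hi.le, h.eq_top] at h3
  exact absurd (h.2 h3.symm) (by omega)

variable {x : L} {a : LieIdeal F L}

/-- Outside `U⁽ⁱ⁺¹⁾`, some weight vector of `𝔫` leads outside `U⁽ⁱ⁾`. -/
theorem IsDiagSemidirect.exists_weight_lie_notMem (h : IsDiagSemidirect x a) {i : ℕ} {u : U}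
    (hu : u ∉ nilpSeries F L U (i + 1)) :
    ∃ δ : F, δ ≠ 0 ∧ ∃ v ∈ adEigenspace x a δ, ⁅v, u⁆ ∉ nilpSeries F L U i := by
  by_contra! hcon
  apply hu
  intro z hz
  have hz' := h.mem_span_weight hz
  clear hz
  induction hz' using Submodule.span_induction with
  | mem v hv => obtain ⟨δ, hδ, hv⟩ := hv; exact hcon δ hδ v hv
  | zero => simp
  | add z w _ _ hz hw => rw [add_lie]; exact (nilpSeries F L U i).add_mem hz hw
  | smul c z _ hz => rw [smul_lie]; exact (nilpSeries F L U i).smul_mem _ hz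

/-- An element of `𝔞` which sends `U⁽ⁱ⁾` into `U⁽ʲ⁾` sends `U⁽ⁱ⁺¹⁾` into `U⁽ʲ⁺¹⁾`. -/
theorem IsDiagSemidirect.lie_mem_succ (h : IsDiagSemidirect x a) {i j : ℕ} {w : L} (hw : w ∈ a)
    (hij : ∀ u ∈ nilpSeries F L U i, ⁅w, u⁆ ∈ nilpSeries F L U j) {u : U}
    (hu : u ∈ nilpSeries F L U (i + 1)) : ⁅w, u⁆ ∈ nilpSeries F L U (j + 1) := by
  intro v hv
  rw [h.lie_lie_comm (h.nilRad_le hv) hw]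
  exact hij _ (hu v hv)

theorem aeval_toEnd_mem (N : LieSubmodule F L U) (y : L) (q : F[X]) {u : U} (hu : u ∈ N) :
    aeval (LieModule.toEnd F L U y) q u ∈ N :=
  aeval_mem_of_invariant (N := N.toSubmodule) (fun _ h => N.lie_mem h) q hu

/-- A weight vector `v` of weight `δ` intertwines `q(y)` and `q(y - δ)`. -/
theorem lie_aeval_toEnd {y v : L} {δ : F} (hv : ⁅y, v⁆ = δ • v) (q : F[X]) (u : U) :
    ⁅v, aeval (LieModule.toEnd F L U y) q u⁆ =
      aeval (LieModule.toEnd F L U y) (q.comp (X + C (-δ))) ⁅v, u⁆ := by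
  rw [aeval_comp]
  refine map_aeval_of_intertwines (LieModule.toEnd F L U v) (fun u => ?_) q u
  have h1 : ⁅y, ⁅v, u⁆⁆ = δ • ⁅v, u⁆ + ⁅v, ⁅y, u⁆⁆ := by rw [leibniz_lie, hv, smul_lie]
  simp [h1, Module.algebraMap_end_apply]

end Series

/-! ### Generators of commutative chain algebras -/

section Chain

theorem isLocalRing_of_ideals_chain {A : Type*} [CommRing A] [Nontrivial A]
    (hA : ∀ I J : Ideal A, I ≤ J ∨ J ≤ I) : IsLocalRing A := by
  obtain ⟨I, hI⟩ := Ideal.exists_maximal A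
  refine IsLocalRing.of_unique_max_ideal ⟨I, hI, fun J hJ => ?_⟩
  rcases hA I J with h | h
  · exact (hI.eq_of_le hJ.ne_top h).symm
  · exact hJ.eq_of_le hI.ne_top h

open IsLocalRing in
theorem maximalIdeal_eq_span_of_notMem_sq {A : Type*} [CommRing A] [IsLocalRing A]
    (hA : ∀ I J : Ideal A, I ≤ J ∨ J ≤ I) {t : A} (ht : t ∈ maximalIdeal A)
    (ht2 : t ∉ maximalIdeal A ^ 2) : maximalIdeal A = Ideal.span {t} := by
  refine le_antisymm (fun u hu => ?_) ((Ideal.span_singleton_le_iff_mem _).mpr ht)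
  rcases hA (Ideal.span {u}) (Ideal.span {t}) with h | h
  · exact h (Ideal.mem_span_singleton_self u)
  · obtain ⟨c, rfl⟩ := Ideal.mem_span_singleton.mp (h (Ideal.mem_span_singleton_self t))
    by_cases hc : IsUnit c
    · obtain ⟨c', hc'⟩ := hc.exists_right_inv
      exact Ideal.mem_span_singleton.mpr ⟨c', by rw [mul_assoc, hc', mul_one]⟩
    · exact absurd (by rw [pow_two]; exact Ideal.mul_mem_mul hu hc) ht2

/-- Pulling back a proper subalgebra along a linear map whose image generates yields a proper
subspace. -/
theorem comap_subalgebra_ne_top {F A A' H : Type*} [Field F] [CommRing A] [Algebra F A]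
    [CommRing A'] [Algebra F A'] [AddCommGroup H] [Module F H] {ψ : H →ₗ[F] A}
    (hψ : Algebra.adjoin F (Set.range ψ) = ⊤) {f : A →ₐ[F] A'} (hf : Function.Surjective f)
    {S : Subalgebra F A'} (hS : S ≠ ⊤) :
    (Subalgebra.toSubmodule S).comap (f.toLinearMap ∘ₗ ψ) ≠ ⊤ := by
  intro htop
  apply hS
  have h1 : Algebra.adjoin F (Set.range ψ) ≤ S.comap f := by
    refine Algebra.adjoin_le ?_
    rintro _ ⟨h, rfl⟩
    have : h ∈ (Subalgebra.toSubmodule S).comap (f.toLinearMap ∘ₗ ψ) := by rw [htop]; trivial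
    exact this
  rw [hψ] at h1
  rw [eq_top_iff]
  rintro z -
  obtain ⟨r, rfl⟩ := hf z
  exact h1 trivial

variable {F : Type*} [Field F] {A : Type*} [CommRing A] [Algebra F A] [FiniteDimensional F A]

open IsLocalRing in
/-- A subalgebra of a finite dimensional local algebra which covers the residue field and contains
a generator of the maximal ideal is everything. -/
theorem subalgebra_eq_top_of_residue [IsLocalRing A] {B : Subalgebra F A}
    (hB : ∀ r, ∃ b ∈ B, r - b ∈ maximalIdeal A) {t : A} (ht : t ∈ B)
    (hm : maximalIdeal A = Ideal.span {t}) : B = ⊤ := by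
  have hnil : IsNilpotent t := by
    have : IsArtinianRing A := .of_finite F A
    obtain ⟨n, hn⟩ := IsArtinianRing.isNilpotent_jacobson_bot (R := A)
    rw [jacobson_eq_maximalIdeal ⊥ bot_ne_top] at hn
    have h1 : t ^ n ∈ maximalIdeal A ^ n :=
      Ideal.pow_mem_pow (hm ▸ Ideal.mem_span_singleton_self t) n
    rw [hn] at h1
    exact ⟨n, by simpa using h1⟩
  have key : ∀ n : ℕ, ∀ r, ∃ b ∈ B, ∃ c, r - b = t ^ n * c := by
    intro n
    induction n with
    | zero => exact fun r => ⟨0, B.zero_mem, r, by simp⟩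
    | succ n ih =>
      intro r
      obtain ⟨b, hb, c, hc⟩ := ih r
      obtain ⟨b', hb', hc'⟩ := hB c
      rw [hm] at hc'
      obtain ⟨e, he⟩ := Ideal.mem_span_singleton.mp hc'
      refine ⟨b + t ^ n * b', B.add_mem hb (B.mul_mem (B.pow_mem ht n) hb'), e, ?_⟩
      rw [pow_succ, mul_assoc, ← he, mul_sub, ← hc]
      ring
  obtain ⟨n, hn⟩ := hnil
  rw [eq_top_iff]
  rintro r -
  obtain ⟨b, hb, c, hc⟩ := key n r
  rw [hn, zero_mul, sub_eq_zero] at hc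
  rw [hc]; exact hb

/-- Over a perfect field, the semisimple multiplication operators on `A` are those in a
subalgebra. -/
def semisimpleSubalgebra (F : Type*) [Field F] [PerfectField F] (A : Type*) [CommRing A]
    [Algebra F A] [FiniteDimensional F A] : Subalgebra F A where
  carrier := {r | (Algebra.lmul F A r).IsSemisimple}
  mul_mem' {r s} hr hs := by
    change Module.End.IsSemisimple _
    rw [map_mul]
    exact Module.End.IsSemisimple.mul_of_commute ((Commute.all r s).map _) hr hs
  add_mem' {r s} hr hs := by
    change Module.End.IsSemisimple _
    rw [map_add]
    exact Module.End.IsSemisimple.add_of_commute ((Commute.all r s).map _) hr hs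
  algebraMap_mem' c := by
    change Module.End.IsSemisimple _
    rw [AlgHom.commutes, Algebra.algebraMap_eq_smul_one]
    exact Module.End.IsSemisimple_smul c Module.End.isSemisimple_id

theorem eq_zero_of_mem_semisimpleSubalgebra [PerfectField F] {t : A}
    (ht : t ∈ semisimpleSubalgebra F A) (hn : IsNilpotent t) : t = 0 := by
  have h0 := Module.End.eq_zero_of_isNilpotent_isSemisimple (hn.map (Algebra.lmul F A)) ht
  simpa using LinearMap.congr_fun h0 1

variable {H : Type*} [AddCommGroup H] [Module F H]

open IsLocalRing in
/-- Let a finite dimensional commutative chain algebra over a perfect field be generated by a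
linear family. Outside finitely many proper subspaces, each single member of the family
generates: it is enough to avoid the proper subfields of the residue field and, modulo the square
of the maximal ideal, the subalgebra of semisimple elements. -/
theorem exists_finite_forall_adjoin_eq_top [PerfectField F]
    (hA : ∀ I J : Ideal A, I ≤ J ∨ J ≤ I) (ψ : H →ₗ[F] A)
    (hψ : Algebra.adjoin F (Set.range ψ) = ⊤) :
    ∃ T : Set (Submodule F H), T.Finite ∧ ⊤ ∉ T ∧
      ∀ y, (∀ N ∈ T, y ∉ N) → Algebra.adjoin F {ψ y} = ⊤ := by
  rcases subsingleton_or_nontrivial A with hsub | hnt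
  · exact ⟨∅, Set.finite_empty, by simp, fun y _ => by
      rw [eq_top_iff]; rintro r -; rw [Subsingleton.elim r 0]; exact zero_mem _⟩
  have := isLocalRing_of_ideals_chain hA
  have : IsNoetherianRing A := isNoetherian_of_tower F inferInstance
  set m := maximalIdeal A with hmdef
  set K := ResidueField A
  let res : A →ₐ[F] K := Ideal.Quotient.mkₐ F m
  have hres : Function.Surjective res := Ideal.Quotient.mkₐ_surjective F m
  have hres0 : ∀ r, res r = 0 ↔ r ∈ m := fun r => Ideal.Quotient.eq_zero_iff_mem
  have : FiniteDimensional F K := Module.Finite.of_surjective res.toLinearMap hres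
  have hfin : Finite (IntermediateField F K) :=
    (Field.exists_primitive_element_iff_finite_intermediateField F K).mp
      ⟨inferInstance, Field.exists_primitive_element F K⟩
  let sq : A →ₐ[F] (A ⧸ m ^ 2) := Ideal.Quotient.mkₐ F (m ^ 2)
  have hsq : Function.Surjective sq := Ideal.Quotient.mkₐ_surjective F (m ^ 2)
  have hsq0 : ∀ r, sq r = 0 ↔ r ∈ m ^ 2 := fun r => Ideal.Quotient.eq_zero_iff_mem
  have : FiniteDimensional F (A ⧸ m ^ 2) := Module.Finite.of_surjective sq.toLinearMap hsq
  let T1 : Set (Submodule F H) := (fun E : IntermediateField F K =>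
    (Subalgebra.toSubmodule E.toSubalgebra).comap (res.toLinearMap ∘ₗ ψ)) '' {E | E ≠ ⊤}
  let T2 : Submodule F H := (Subalgebra.toSubmodule
    (semisimpleSubalgebra F (A ⧸ m ^ 2))).comap (sq.toLinearMap ∘ₗ ψ)
  have hT1 : ⊤ ∉ T1 := by
    rintro ⟨E, hE, h⟩
    refine comap_subalgebra_ne_top hψ hres (S := E.toSubalgebra) (fun h => hE ?_) h
    exact IntermediateField.toSubalgebra_injective (by simpa using h)
  -- the residue field is covered by `F[y]`
  have hcover : ∀ y, (∀ N ∈ T1, y ∉ N) → ∀ r, ∃ b ∈ Algebra.adjoin F {ψ y}, r - b ∈ m := by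
    intro y hy r
    have htop : IntermediateField.adjoin F {res (ψ y)} = ⊤ := by
      by_contra hne
      exact hy _ ⟨_, hne, rfl⟩ (IntermediateField.mem_adjoin_simple_self F (res (ψ y)))
    have h2 : Algebra.adjoin F {res (ψ y)} = ⊤ := by
      rw [← IntermediateField.adjoin_simple_toSubalgebra_of_isAlgebraic
        (Algebra.IsAlgebraic.isAlgebraic _), htop, IntermediateField.top_toSubalgebra]
    have h3 : res r ∈ Algebra.adjoin F {res (ψ y)} := by rw [h2]; trivial
    rw [← Set.image_singleton, ← AlgHom.map_adjoin] at h3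
    obtain ⟨b, hb, hbr⟩ := h3
    refine ⟨b, hb, (hres0 _).mp ?_⟩
    rw [map_sub, sub_eq_zero]
    exact hbr.symm
  by_cases hm0 : m = ⊥
  · refine ⟨T1, (Set.toFinite _).image _, hT1, fun y hy => ?_⟩
    exact subalgebra_eq_top_of_residue (hcover y hy) (zero_mem _) (by simpa using hm0)
  · refine ⟨insert T2 T1, ((Set.toFinite _).image _).insert _, ?_, fun y hy => ?_⟩
    · rintro (h | h)
      swap
      · exact hT1 h
      refine comap_subalgebra_ne_top hψ hsq (fun h => hm0 ?_) h.symm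
      refine Submodule.eq_bot_of_le_smul_of_le_jacobson_bot m m (IsNoetherian.noetherian m) ?_
        (IsLocalRing.maximalIdeal_le_jacobson ⊥)
      intro t ht
      rw [smul_eq_mul, ← pow_two, ← hsq0]
      refine eq_zero_of_mem_semisimpleSubalgebra (F := F) (by rw [h]; trivial) ⟨2, ?_⟩
      rw [← map_pow, hsq0]
      exact Ideal.pow_mem_pow ht 2
    · have hint : IsIntegral F (res (ψ y)) := Algebra.IsIntegral.isIntegral _
      have ht : aeval (ψ y) (minpoly F (res (ψ y))) ∈ m := by
        rw [← hres0, ← aeval_algHom_apply, minpoly.aeval]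
      have ht2 : aeval (ψ y) (minpoly F (res (ψ y))) ∉ m ^ 2 := by
        intro hmem
        apply hy T2 (Set.mem_insert _ _)
        change Module.End.IsSemisimple (Algebra.lmul F (A ⧸ m ^ 2) (sq (ψ y)))
        refine Module.End.isSemisimple_of_squarefree_aeval_eq_zero
          (minpoly.irreducible hint).squarefree ?_
        rw [aeval_algHom_apply, aeval_algHom_apply, (hsq0 _).mpr hmem, map_zero]
      refine subalgebra_eq_top_of_residue
        (hcover y fun N hN => hy N (Set.mem_insert_of_mem _ hN)) ?_
        (maximalIdeal_eq_span_of_notMem_sq hA ht ht2)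
      exact aeval_mem_adjoin_singleton F (ψ y)

end Chain

section Uniserial

/-- A Noetherian module whose submodules form a chain is cyclic. -/
theorem exists_span_singleton_eq_top {R V : Type*} [Ring R] [AddCommGroup V] [Module R V]
    [IsNoetherian R V] (hV : ∀ N N' : Submodule R V, N ≤ N' ∨ N' ≤ N) :
    ∃ v : V, Submodule.span R {v} = ⊤ := by
  obtain ⟨N, ⟨v, rfl⟩, hmax⟩ := set_has_maximal_iff_noetherian.mpr ‹IsNoetherian R V›
    (Set.range fun v : V => Submodule.span R {v}) ⟨_, 0, rfl⟩
  refine ⟨v, ?_⟩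
  rw [eq_top_iff]
  rintro w -
  rcases hV (Submodule.span R {w}) (Submodule.span R {v}) with h | h
  · exact h (Submodule.mem_span_singleton_self w)
  · by_contra hw
    exact hmax _ ⟨w, rfl⟩ (lt_of_le_of_ne h fun he =>
      hw ((show Submodule.span R {v} = Submodule.span R {w} from he) ▸
        Submodule.mem_span_singleton_self w))

/-- A commutative algebra acting faithfully on a module whose submodules form a chain is itself a
chain ring, since the module is cyclic. -/
theorem ideals_chain_of_faithful {A V : Type*} [CommRing A] [AddCommGroup V] [Module A V]
    [FaithfulSMul A V] [IsNoetherian A V]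
    (hV : ∀ N N' : Submodule A V, N ≤ N' ∨ N' ≤ N) (I J : Ideal A) : I ≤ J ∨ J ≤ I := by
  obtain ⟨v, hv⟩ := exists_span_singleton_eq_top hV
  have hfaith : ∀ r s : A, r • v = s • v → r = s := by
    intro r s hrs
    refine eq_of_smul_eq_smul (α := V) fun w => ?_
    have hw : w ∈ Submodule.span A {v} := by rw [hv]; trivial
    obtain ⟨t, rfl⟩ := Submodule.mem_span_singleton.mp hw
    rw [smul_comm r, smul_comm s, hrs]
  have aux : ∀ I J : Ideal A, Submodule.map (LinearMap.toSpanSingleton A V v) I ≤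
      Submodule.map (LinearMap.toSpanSingleton A V v) J → I ≤ J := by
    intro I J h r hr
    obtain ⟨s, hs, hrs⟩ := h (Submodule.mem_map_of_mem hr)
    rw [← hfaith s r hrs]; exact hs
  exact (hV _ _).imp (aux I J) (aux J I)

variable {F : Type*} [Field F] {H : Type*} [AddCommGroup H] [Module F H]
  {V : Type*} [AddCommGroup V] [Module F V] [FiniteDimensional F V]

/-- If the common invariant subspaces of a linear family of commuting operators form a chain, then
outside finitely many proper subspaces of the family each single operator has no invariant
subspaces other than the common ones. -/
theorem exists_finite_forall_invariant [PerfectField F] (Φ : H →ₗ[F] Module.End F V)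
    (hcomm : ∀ h k, Φ h * Φ k = Φ k * Φ h)
    (hV : ∀ N N' : Submodule F V, (∀ h, ∀ u ∈ N, Φ h u ∈ N) → (∀ h, ∀ u ∈ N', Φ h u ∈ N') →
      N ≤ N' ∨ N' ≤ N) :
    ∃ T : Set (Submodule F H), T.Finite ∧ ⊤ ∉ T ∧ ∀ y, (∀ S ∈ T, y ∉ S) →
      ∀ N : Submodule F V, (∀ u ∈ N, Φ y u ∈ N) → ∀ h, ∀ u ∈ N, Φ h u ∈ N := by
  let A := Algebra.adjoin F (Set.range Φ)
  let _ : CommRing A := { (inferInstance : Ring A) with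
    mul_comm := (Algebra.isMulCommutative_adjoin F (s := Set.range Φ) (by
      rintro _ ⟨h, rfl⟩ _ ⟨k, rfl⟩; exact hcomm h k)).is_comm.comm }
  let ψ : H →ₗ[F] A := Φ.codRestrict (Subalgebra.toSubmodule A)
    fun h => Algebra.subset_adjoin ⟨h, rfl⟩
  have hψ : Algebra.adjoin F (Set.range ψ) = ⊤ := by
    refine Eq.trans ?_ (Algebra.adjoin_adjoin_coe_preimage (R := F) (s := Set.range Φ))
    congr 1
    ext r
    constructor
    · rintro ⟨h, rfl⟩; exact ⟨h, rfl⟩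
    · rintro ⟨h, hh⟩; exact ⟨h, Subtype.ext hh⟩
  have hchain : ∀ N N' : Submodule A V, N ≤ N' ∨ N' ≤ N := by
    intro N N'
    exact hV (N.restrictScalars F) (N'.restrictScalars F)
      (fun h u hu => N.smul_mem (ψ h) hu) (fun h u hu => N'.smul_mem (ψ h) hu)
  have : IsNoetherian A V := isNoetherian_of_tower F inferInstance
  have : FaithfulSMul A V := ⟨fun h => Subtype.ext (LinearMap.ext h)⟩
  obtain ⟨T, hT, htop, hgen⟩ :=
    exists_finite_forall_adjoin_eq_top (ideals_chain_of_faithful hchain) ψ hψ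
  refine ⟨T, hT, htop, fun y hy N hN h u hu => ?_⟩
  have h1 : ψ h ∈ Algebra.adjoin F {ψ y} := by rw [hgen y hy]; trivial
  have h2 : ∀ r ∈ Algebra.adjoin F {ψ y}, ∀ u ∈ N, r • u ∈ N := by
    intro r hr
    induction hr using Algebra.adjoin_induction with
    | mem r hr => rw [Set.mem_singleton_iff.mp hr]; exact hN
    | algebraMap c => intro u hu; exact N.smul_mem c hu
    | add r s _ _ hr hs => intro u hu; rw [add_smul]; exact N.add_mem (hr u hu) (hs u hu)
    | mul r s _ _ hr hs => intro u hu; rw [mul_smul]; exact hr _ (hs u hu)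
  exact h2 _ h1 u hu

/-- A finite dimensional nonzero `F[X]`-module whose submodules form a chain is `F[X]/(pˢ)` for
some monic irreducible polynomial `p`. -/
theorem exists_equiv_quotient_span_pow {W : Type*} [AddCommGroup W] [Module F W] [Module F[X] W]
    [IsScalarTower F F[X] W] [FiniteDimensional F W] [Nontrivial W]
    (hW : ∀ N N' : Submodule F[X] W, N ≤ N' ∨ N' ≤ N) :
    ∃ (p : F[X]) (s : ℕ), p.Monic ∧ Irreducible p ∧
      Nonempty (W ≃ₗ[F[X]] (F[X] ⧸ Ideal.span {p ^ s})) := by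
  have : IsNoetherian F[X] W := isNoetherian_of_tower F inferInstance
  obtain ⟨v, hv⟩ := exists_span_singleton_eq_top hW
  let φ := LinearMap.toSpanSingleton F[X] W v
  have hφ : Function.Surjective φ := by
    rw [← LinearMap.range_eq_top, LinearMap.range_toSpanSingleton, hv]
  obtain ⟨f, hf⟩ := IsPrincipalIdealRing.principal (LinearMap.ker φ)
  have hf' : LinearMap.ker φ = Ideal.span {f} := hf
  have hdvd : ∀ q, φ q = 0 ↔ f ∣ q := fun q => by
    rw [← LinearMap.mem_ker, hf', Ideal.mem_span_singleton]
  have hf0 : f ≠ 0 := by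
    rintro rfl
    have hinj : Function.Injective (φ.restrictScalars F) := by
      rw [← LinearMap.ker_eq_bot, eq_bot_iff]
      intro q hq
      simpa using (hdvd q).mp hq
    have : FiniteDimensional F F[X] := FiniteDimensional.of_injective _ hinj
    exact Polynomial.not_finite this
  have hfu : ¬ IsUnit f := by
    intro hu
    have h1 : φ 1 = 0 := (hdvd 1).mpr hu.dvd
    obtain ⟨w, hw⟩ := exists_ne (0 : W)
    obtain ⟨q, rfl⟩ := hφ w
    apply hw
    rw [← mul_one q, ← smul_eq_mul, map_smul, h1, smul_zero]
  -- the irreducible factors of `f` are pairwise associated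
  have hassoc : ∀ p q : F[X], Irreducible p → Irreducible q → p ∣ f → q ∣ f → p ∣ q := by
    intro p q hp hq hpf hqf
    have aux : ∀ p q : F[X], p ∣ f → Submodule.map φ (Ideal.span {q}) ≤ Submodule.map φ (Ideal.span {p}) → p ∣ q := by
      intro p q hpf h
      obtain ⟨r, hr, hrq⟩ := h (Submodule.mem_map_of_mem (Ideal.mem_span_singleton_self q))
      have h2 : f ∣ r - q := (hdvd _).mp (by rw [map_sub, hrq, sub_self])
      have h3 := Ideal.mem_span_singleton.mp hr
      exact (dvd_sub_right h3).mp (hpf.trans h2)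
    rcases hW (Submodule.map φ (Ideal.span {q})) (Submodule.map φ (Ideal.span {p})) with h | h
    · exact aux p q hpf h
    · exact (hq.associated_of_dvd hp (aux q p hqf h)).symm.dvd
  obtain ⟨p, hpm, hp, hpf⟩ := Polynomial.exists_monic_irreducible_factor f hfu
  obtain ⟨g, hfg, hg⟩ := (FiniteMultiplicity.of_not_isUnit hp.not_isUnit
    hf0).exists_eq_pow_mul_and_not_dvd
  set s := multiplicity p f
  have hgu : IsUnit g := by
    by_contra hgu
    obtain ⟨q, -, hq, hqg⟩ := Polynomial.exists_monic_irreducible_factor g hgu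
    exact hg ((hassoc p q hp hq hpf (hfg ▸ hqg.mul_left _)).trans hqg)
  have hspan : Ideal.span {f} = Ideal.span {p ^ s} := by
    rw [Ideal.span_singleton_eq_span_singleton, hfg]
    exact (associated_mul_unit_right _ _ hgu).symm
  exact ⟨p, s, hpm, hp, ⟨((Submodule.quotEquivOfEq _ _ (hf'.trans hspan)).symm.trans
    (φ.quotKerEquivOfSurjective hφ)).symm⟩⟩

end Uniserial

/-! ### Generators of the nilpotency factors -/

section Factors

variable {F : Type*} [Field F] {L : Type*} [LieRing L] [LieAlgebra F L]
  {U : Type*} [AddCommGroup U] [Module F U] [LieRingModule L U] [LieModule F L U]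

/-- The vector `g ∈ U⁽ⁱ⁺¹⁾` generates `U⁽ⁱ⁺¹⁾` modulo `U⁽ⁱ⁾` under the action of `F[y]`, and its
annihilator modulo `U⁽ⁱ⁾` is generated by `f`. Indices are shifted by one as in `NilpFactor`. -/
structure IsFactorGenerator (y : L) (i : ℕ) (f : F[X]) (g : U) : Prop where
  mem : g ∈ nilpSeries F L U (i + 1)
  exists_aeval_sub_mem : ∀ u ∈ nilpSeries F L U (i + 1),
    ∃ q : F[X], u - aeval (LieModule.toEnd F L U y) q g ∈ nilpSeries F L U i
  aeval_mem_iff : ∀ q : F[X], aeval (LieModule.toEnd F L U y) q g ∈ nilpSeries F L U i ↔ f ∣ q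

/-- The quotient map onto the `i`-th nilpotency factor. -/
noncomputable def factorMk (F : Type*) [Field F] (L : Type*) [LieRing L] [LieAlgebra F L]
    (U : Type*) [AddCommGroup U] [Module F U] [LieRingModule L U] [LieModule F L U] (i : ℕ) :
    nilpSeries F L U (i + 1) →ₗ⁅F,L⁆ NilpFactor F L U i :=
  LieSubmodule.Quotient.mk' _

theorem factorMk_surjective (i : ℕ) : Function.Surjective (factorMk F L U i) :=
  LieSubmodule.Quotient.surjective_mk' _

theorem factorMk_eq_zero {i : ℕ} {u : nilpSeries F L U (i + 1)} :
    factorMk F L U i u = 0 ↔ (u : U) ∈ nilpSeries F L U i := by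
  exact LieSubmodule.Quotient.mk_eq_zero
    ((nilpSeries F L U i).comap (nilpSeries F L U (i + 1)).incl)

theorem smul_of_factorMk (y : L) {i : ℕ} (q : F[X]) (u : nilpSeries F L U (i + 1)) :
    q • (Module.AEval'.of (LieModule.toEnd F L (NilpFactor F L U i) y) (factorMk F L U i u)) =
      Module.AEval'.of (LieModule.toEnd F L (NilpFactor F L U i) y) (factorMk F L U i
        ⟨aeval (LieModule.toEnd F L U y) q (u : U), aeval_toEnd_mem _ y q u.2⟩) := by
  have h1 : aeval (LieModule.toEnd F L (NilpFactor F L U i) y) q (factorMk F L U i u) =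
      factorMk F L U i (aeval (LieModule.toEnd F L (nilpSeries F L U (i + 1)) y) q u) :=
    (map_aeval_of_intertwines (T := LieModule.toEnd F L (nilpSeries F L U (i + 1)) y)
      (factorMk F L U i).toLinearMap (fun u => (factorMk F L U i).map_lie y u) q u).symm
  have h2 : ((aeval (LieModule.toEnd F L (nilpSeries F L U (i + 1)) y) q u :
      nilpSeries F L U (i + 1)) : U) = aeval (LieModule.toEnd F L U y) q (u : U) :=
    map_aeval_of_intertwines (T := LieModule.toEnd F L (nilpSeries F L U (i + 1)) y)
      (nilpSeries F L U (i + 1)).incl.toLinearMap (fun u => rfl) q u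
  refine (Module.AEval.of_aeval_smul (R := F) _ q (factorMk F L U i u)).symm.trans ?_
  congr 1
  refine h1.trans ?_
  congr 1
  exact Subtype.ext h2

theorem exists_isFactorGenerator {y : L} {i : ℕ} {f : F[X]}
    (e : FactorAEval F U y i ≃ₗ[F[X]] (F[X] ⧸ Ideal.span {f})) :
    ∃ g : U, IsFactorGenerator y i f g := by
  set o := Module.AEval'.of (LieModule.toEnd F L (NilpFactor F L U i) y)
  have hlift : ∀ w : FactorAEval F U y i, ∃ u : nilpSeries F L U (i + 1),
      o (factorMk F L U i u) = w := by
    intro w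
    obtain ⟨w', rfl⟩ := o.surjective w
    obtain ⟨u, rfl⟩ := factorMk_surjective i w'
    exact ⟨u, rfl⟩
  have ho : ∀ u : nilpSeries F L U (i + 1), o (factorMk F L U i u) = 0 ↔
      (u : U) ∈ nilpSeries F L U i := fun u => by
    rw [LinearEquiv.map_eq_zero_iff, factorMk_eq_zero]
  obtain ⟨g, hg⟩ := hlift (e.symm (Ideal.Quotient.mk _ 1))
  have heg : ∀ q : F[X], e (q • o (factorMk F L U i g)) = Ideal.Quotient.mk _ q := by
    intro q
    rw [hg, map_smul, LinearEquiv.apply_symm_apply, ← Ideal.Quotient.mk_eq_mk,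
      ← Submodule.Quotient.mk_smul, smul_eq_mul, mul_one, Ideal.Quotient.mk_eq_mk]
  refine ⟨g, g.2, fun u hu => ?_, fun q => ?_⟩
  · obtain ⟨q, hq⟩ := Ideal.Quotient.mk_surjective (e (o (factorMk F L U i ⟨u, hu⟩)))
    refine ⟨q, (ho (⟨u, hu⟩ - ⟨_, aeval_toEnd_mem _ y q g.2⟩)).mp ?_⟩
    rw [map_sub, map_sub, ← smul_of_factorMk, sub_eq_zero]
    apply e.injective
    rw [heg, hq]
  · rw [← ho ⟨_, aeval_toEnd_mem _ y q g.2⟩, ← smul_of_factorMk, ← e.map_eq_zero_iff, heg,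
      Ideal.Quotient.eq_zero_iff_mem, Ideal.mem_span_singleton]

theorem IsFactorGenerator.aeval_mem {y : L} {i : ℕ} {f : F[X]} {g : U}
    (h : IsFactorGenerator y i f g) {u : U} (hu : u ∈ nilpSeries F L U (i + 1)) :
    aeval (LieModule.toEnd F L U y) f u ∈ nilpSeries F L U i := by
  obtain ⟨q, hq⟩ := h.exists_aeval_sub_mem u hu
  have h1 := aeval_toEnd_mem _ y f hq
  rw [map_sub] at h1
  refine (Submodule.sub_mem_iff_left (nilpSeries F L U i).toSubmodule ?_).mp h1
  change _ ∈ nilpSeries F L U i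
  rw [← Module.End.mul_apply, ← map_mul, h.aeval_mem_iff]
  exact dvd_mul_right f q

/-- If a vector of weight `δ` acts nontrivially modulo `N` between parts of `U` that are
`p`-primary and `q`-primary with respect to `y`, then `q = p(X - δ)`. -/
theorem comp_eq_of_lie_notMem {y v : L} {δ : F} (hv : ⁅y, v⁆ = δ • v) {N : LieSubmodule F L U}
    {p q : F[X]} (hpm : p.Monic) (hp : Irreducible p) (hqm : q.Monic) (hq : Irreducible q)
    {k l : ℕ} {u : U} (hu : ⁅v, u⁆ ∉ N)
    (h1 : ⁅v, aeval (LieModule.toEnd F L U y) (p ^ k) u⁆ ∈ N)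
    (h2 : aeval (LieModule.toEnd F L U y) (q ^ l) ⁅v, u⁆ ∈ N) :
    p.comp (X + C (-δ)) = q := by
  refine eq_of_not_isCoprime_pow (irreducible_comp_X_add_C hp _) hq
    (monic_comp_X_add_C hpm _) hqm (k := k) (l := l) fun hco => hu ?_
  refine mem_of_isCoprime (T := LieModule.toEnd F L U y) (N := N.toSubmodule)
    (fun _ h => N.lie_mem h) hco ?_ h2
  rw [lie_aeval_toEnd hv, pow_comp] at h1
  exact h1

end Factors

/-! ### Existence of adapted data -/

section Existence

variable {F : Type*} [Field F] {L : Type*} [LieRing L] [LieAlgebra F L]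
  {U : Type*} [AddCommGroup U] [Module F U] [LieRingModule L U] [LieModule F L U]
  {x : L} {a : LieIdeal F L}

/-- Some weight vector of `𝔫` acts nontrivially between any two consecutive nilpotency factors.
It suffices that it does so at the top, since `v U⁽ⁱ⁺²⁾ ⊆ U⁽ⁱ⁾` implies
`v U⁽ⁱ⁺³⁾ ⊆ U⁽ⁱ⁺¹⁾`. -/
theorem IsDiagSemidirect.exists_weight_forall (h : IsDiagSemidirect x a) {m : ℕ} (hm : 1 < m)
    (hlen : IsNilpLength F L U m) :
    ∃ δ : F, δ ≠ 0 ∧ ∃ v ∈ adEigenspace x a δ, ∀ i, i + 1 < m →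
      ∃ u ∈ nilpSeries F L U (i + 2), ⁅v, u⁆ ∉ nilpSeries F L U i := by
  obtain ⟨k, rfl⟩ : ∃ k, m = k + 2 := ⟨m - 2, by omega⟩
  obtain ⟨u, -, hu⟩ := hlen.exists_notMem (i := k + 1) (by omega)
  obtain ⟨δ, hδ, v, hv, hvu⟩ := h.exists_weight_lie_notMem hu
  refine ⟨δ, hδ, v, hv, fun i hi => ?_⟩
  by_contra! hcon
  have hprop : ∀ n, ∀ u ∈ nilpSeries F L U (i + 2 + n), ⁅v, u⁆ ∈ nilpSeries F L U (i + n) := by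
    intro n
    induction n with
    | zero => exact hcon
    | succ n ih => exact fun u hu => h.lie_mem_succ (mem_adEigenspace.mp hv).1 ih hu
  have h1 := hprop (k - i) u (by
    rw [show i + 2 + (k - i) = k + 2 by omega, hlen.eq_top]; trivial)
  rw [show i + (k - i) = k by omega] at h1
  exact hvu h1

theorem IsDiagSemidirect.lie_zero_weight (h : IsDiagSemidirect x a) {y z : L}
    (hy : y ∈ Submodule.span F {x} ⊔ adEigenspace x a 0)
    (hz : z ∈ Submodule.span F {x} ⊔ adEigenspace x a 0) : ⁅y, z⁆ = 0 := by
  obtain ⟨_, hc, u, hu, rfl⟩ := Submodule.mem_sup.mp hy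
  obtain ⟨c, rfl⟩ := Submodule.mem_span_singleton.mp hc
  obtain ⟨_, hd, w, hw, rfl⟩ := Submodule.mem_sup.mp hz
  obtain ⟨d, rfl⟩ := Submodule.mem_span_singleton.mp hd
  rw [mem_adEigenspace] at hu hw
  have hux : ⁅u, x⁆ = 0 := by rw [← lie_skew, hu.2]; simp
  simp [h.lie_eq_zero hu.1 hw.1, hw.2, hux]

/-- Since `𝔫` acts trivially on a nilpotency factor, a subspace invariant under `⟨x⟩ ⊕ 𝔞₀` is a
submodule. -/
theorem IsDiagSemidirect.invariant_factor (h : IsDiagSemidirect x a) {i : ℕ}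
    {N : Submodule F (NilpFactor F L U i)}
    (hN : ∀ y ∈ Submodule.span F {x} ⊔ adEigenspace x a 0, ∀ w ∈ N, ⁅y, w⁆ ∈ N) (z : L)
    {w : NilpFactor F L U i} (hw : w ∈ N) : ⁅z, w⁆ ∈ N := by
  obtain ⟨c, u, hu, rfl⟩ := h.exists_eq z
  rw [add_lie]
  refine N.add_mem (hN _ (Submodule.mem_sup_left
    (Submodule.smul_mem _ _ (Submodule.mem_span_singleton_self x))) w hw) ?_
  refine h.induction (P := fun u => ⁅u, w⁆ ∈ N) ?_ ?_ ?_ hu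
  · simp
  · intro u t hu ht; rw [add_lie]; exact N.add_mem hu ht
  · intro δ u hu
    rcases eq_or_ne δ 0 with rfl | hδ
    · exact hN u (Submodule.mem_sup_right hu) w hw
    · obtain ⟨t, rfl⟩ := factorMk_surjective i w
      rw [← LieModuleHom.map_lie, factorMk_eq_zero.mpr]
      · exact N.zero_mem
      · exact t.2 u (h.mem_nilRad hδ hu)

/-- The polynomials attached to consecutive nilpotency factors differ by a shift, and the exponents
decrease, because `U⁽ⁱ⁺²⁾ / U⁽ⁱ⁺¹⁾` embeds into the linear maps from `𝔫` to `U⁽ⁱ⁺¹⁾ / U⁽ⁱ⁾`. -/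
theorem IsDiagSemidirect.factor_succ {y : L} (h : IsDiagSemidirect y a) {v : L}
    (hv : v ∈ adEigenspace y a 1) {i : ℕ}
    (hvi : ∃ u ∈ nilpSeries F L U (i + 2), ⁅v, u⁆ ∉ nilpSeries F L U i)
    {p q : F[X]} (hpm : p.Monic) (hp : Irreducible p) (hqm : q.Monic) (hq : Irreducible q)
    {k l : ℕ} {g g' : U} (hg : IsFactorGenerator y i (p ^ k) g)
    (hg' : IsFactorGenerator y (i + 1) (q ^ l) g') : q = p.comp (X + C 1) ∧ l ≤ k := by
  have hstep : ∀ δ : F, δ ≠ 0 → ∀ v ∈ adEigenspace y a δ, ∀ u ∈ nilpSeries F L U (i + 2),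
      ⁅v, u⁆ ∉ nilpSeries F L U i → q.comp (X + C (-δ)) = p := by
    intro δ hδ v hv u hu hvu
    have hvn := h.mem_nilRad hδ hv
    exact comp_eq_of_lie_notMem (mem_adEigenspace.mp hv).2 hqm hq hpm hp (k := l) (l := k) hvu
      (hg'.aeval_mem hu v hvn) (hg.aeval_mem (hu v hvn))
  constructor
  · obtain ⟨u, hu, hvu⟩ := hvi
    rw [← hstep 1 one_ne_zero v hv u hu hvu, comp_X_add_C_comp]
    simp
  · have hmem : aeval (LieModule.toEnd F L U y) (q ^ k) g' ∈ nilpSeries F L U (i + 1) := by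
      by_contra hcon
      obtain ⟨δ, hδ, w, hw, hwg⟩ := h.exists_weight_lie_notMem hcon
      apply hwg
      by_cases hwg' : ∀ u ∈ nilpSeries F L U (i + 2), ⁅w, u⁆ ∈ nilpSeries F L U i
      · exact hwg' _ (aeval_toEnd_mem _ y _ hg'.mem)
      · push Not at hwg'
        obtain ⟨u, hu, hwu⟩ := hwg'
        rw [lie_aeval_toEnd (mem_adEigenspace.mp hw).2, pow_comp, hstep δ hδ w hw u hu hwu]
        exact hg.aeval_mem (hg'.mem w (h.mem_nilRad hδ hw))
    rw [hg'.aeval_mem_iff] at hmem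
    exact (pow_dvd_pow_iff hq.ne_zero hq.not_isUnit).mp hmem

variable [FiniteDimensional F U]

/-- There is an element of `⟨x⟩ ⊕ 𝔞₀` outside `𝔞₀` whose invariant subspaces in all nilpotency
factors are submodules. -/
theorem IsDiagSemidirect.exists_generic (h : IsDiagSemidirect x a)
    (hF : (Infinite F ∧ PerfectField F) ∨ adEigenspace x a 0 = ⊥) (hU : IsLinked F L U) (m : ℕ) :
    ∃ c : F, c ≠ 0 ∧ ∃ w ∈ adEigenspace x a 0, ∀ i < m,
      ∀ N : Submodule F (NilpFactor F L U i), (∀ u ∈ N, ⁅c • x + w, u⁆ ∈ N) →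
        ∀ z : L, ∀ u ∈ N, ⁅z, u⁆ ∈ N := by
  rcases hF with ⟨hinf, hperf⟩ | h0
  · set H := Submodule.span F {x} ⊔ adEigenspace x a 0 with hH
    let Φ : ∀ i, H →ₗ[F] Module.End F (NilpFactor F L U i) := fun i =>
      { toFun := fun y => LieModule.toEnd F L (NilpFactor F L U i) y
        map_add' := fun y z => map_add (LieModule.toEnd F L (NilpFactor F L U i)) (y : L) z
        map_smul' := fun c y => map_smul (LieModule.toEnd F L (NilpFactor F L U i)) c (y : L) }
    have hT : ∀ i, ∃ T : Set (Submodule F H), T.Finite ∧ ⊤ ∉ T ∧ ∀ y, (∀ S ∈ T, y ∉ S) →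
        ∀ N : Submodule F (NilpFactor F L U i), (∀ u ∈ N, Φ i y u ∈ N) →
          ∀ h, ∀ u ∈ N, Φ i h u ∈ N := by
      intro i
      refine exists_finite_forall_invariant (Φ i) (fun y z => ?_) fun N N' hN hN' => ?_
      · refine LinearMap.ext fun w => ?_
        change ⁅(y : L), ⁅(z : L), w⁆⁆ = ⁅(z : L), ⁅(y : L), w⁆⁆
        rw [leibniz_lie, h.lie_zero_weight y.2 z.2, zero_lie, zero_add]
      · exact hU.uniserial i
          { N with lie_mem := fun {z u} hu =>
              h.invariant_factor (fun y hy w hw => hN ⟨y, hy⟩ w hw) z hu }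
          { N' with lie_mem := fun {z u} hu =>
              h.invariant_factor (fun y hy w hw => hN' ⟨y, hy⟩ w hw) z hu }
    choose T hTfin hTtop hTgood using hT
    let Z : Submodule F H := (adEigenspace x a 0).comap H.subtype
    have hxH : x ∈ H := Submodule.mem_sup_left (Submodule.mem_span_singleton_self x)
    have hZ : Z ≠ ⊤ := by
      intro htop
      have hxZ : (⟨x, hxH⟩ : H) ∈ Z := by rw [htop]; trivial
      have hxa : x ∈ a := (mem_adEigenspace.mp hxZ).1
      have : x ∈ Submodule.span F {x} ⊓ a.toSubmodule :=
        ⟨Submodule.mem_span_singleton_self x, hxa⟩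
      rw [h.isCompl.inf_eq_bot] at this
      exact h.ne_zero this
    have hfin : (insert Z (⋃ i ∈ Set.Iio m, T i)).Finite :=
      ((Set.finite_Iio m).biUnion fun i _ => hTfin i).insert Z
    have hcov := Subspace.biUnion_ne_univ_of_top_notMem (s := hfin.toFinset) (by
      rw [Set.Finite.mem_toFinset]
      rintro (h1 | h1)
      · exact hZ h1.symm
      · obtain ⟨i, -, hi⟩ := Set.mem_iUnion₂.mp h1
        exact hTtop i hi)
    obtain ⟨y, hy⟩ := (Set.ne_univ_iff_exists_notMem _).mp hcov
    have hy' : ∀ S ∈ insert Z (⋃ i ∈ Set.Iio m, T i), y ∉ S := fun S hS hyS =>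
      hy (Set.mem_iUnion₂.mpr ⟨S, hfin.mem_toFinset.mpr hS, hyS⟩)
    obtain ⟨c, hc, w, hw, hyw⟩ := exists_eq_smul_add_of_notMem y.2 (hy' Z (Set.mem_insert _ _))
    refine ⟨c, hc, w, hw, fun i hi N hN z u hu => ?_⟩
    rw [← hyw] at hN
    exact h.invariant_factor (fun t ht u hu => hTgood i y (fun S hS => hy' S
      (Set.mem_insert_of_mem _ (Set.mem_biUnion hi hS))) N hN ⟨t, ht⟩ u hu) z hu
  · refine ⟨1, one_ne_zero, 0, Submodule.zero_mem _, fun i _ N hN z u hu => ?_⟩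
    refine h.invariant_factor (fun t ht u hu => ?_) z hu
    rw [h0, sup_bot_eq] at ht
    obtain ⟨d, rfl⟩ := Submodule.mem_span_singleton.mp ht
    rw [smul_lie]
    have := hN u hu
    rw [one_smul, add_zero] at this
    exact N.smul_mem d this

theorem exists_isAdapted (h : IsDiagSemidirect x a)
    (hF : (Infinite F ∧ PerfectField F) ∨ adEigenspace x a 0 = ⊥) (hU : IsLinked F L U) {m : ℕ}
    (hm : 1 < m) (hlen : IsNilpLength F L U m) :
    ∃ (y : L) (p : ℕ → F[X]) (s : ℕ → ℕ), IsAdapted x a U m y p s := by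
  obtain ⟨δ, hδ, v, hv, hvi⟩ := h.exists_weight_forall hm hlen
  obtain ⟨c, hc, w, hw, hgen⟩ := h.exists_generic hF hU m
  -- rescale the generic element so that `v` has weight `1`
  set y := δ⁻¹ • x + (δ⁻¹ * c⁻¹) • w with hy
  have hw' : (δ⁻¹ * c⁻¹) • w ∈ adEigenspace x a 0 := Submodule.smul_mem _ _ hw
  have hy' : c • x + w = (c * δ) • y := by
    rw [hy, smul_add, smul_smul, smul_smul]
    congr 1
    · congr 1; field_simp
    · rw [show c * δ * (δ⁻¹ * c⁻¹) = 1 by field_simp, one_smul]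
  have hd : IsDiagSemidirect y a := h.replace (inv_ne_zero hδ) hw'
  have hv1 : v ∈ adEigenspace y a 1 := by
    rw [← inv_mul_cancel₀ hδ, h.adEigenspace_mul (inv_ne_zero hδ) hw']
    exact hv
  have huni : ∀ i < m, ∀ N N' : Submodule F[X] (FactorAEval F U y i), N ≤ N' ∨ N' ≤ N := by
    intro i hi N N'
    let o := Module.AEval'.of (LieModule.toEnd F L (NilpFactor F L U i) y)
    have hinv : ∀ N : Submodule F[X] (FactorAEval F U y i), ∀ z : L,
        ∀ u ∈ (N.restrictScalars F).comap o.toLinearMap,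
          ⁅z, u⁆ ∈ (N.restrictScalars F).comap o.toLinearMap := by
      intro N
      refine hgen i hi _ fun u hu => ?_
      rw [hy', smul_lie]
      refine Submodule.smul_mem _ _ ?_
      have h1 : (X : F[X]) • o u ∈ N := N.smul_mem X hu
      rw [Module.AEval'.X_smul_of] at h1
      exact h1
    have h2 := hU.uniserial i
      { (N.restrictScalars F).comap o.toLinearMap with lie_mem := fun {z u} hu => hinv N z u hu }
      { (N'.restrictScalars F).comap o.toLinearMap with lie_mem := fun {z u} hu => hinv N' z u hu }
    refine h2.imp (fun h3 w hw => ?_) (fun h3 w hw => ?_)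
    all_goals
      obtain ⟨w, rfl⟩ := o.surjective w
      exact h3 hw
  have hfac : ∀ i, ∃ (p : F[X]) (s : ℕ), i < m → p.Monic ∧ Irreducible p ∧
      Nonempty (FactorAEval F U y i ≃ₗ[F[X]] (F[X] ⧸ Ideal.span {p ^ s})) := by
    intro i
    by_cases hi : i < m
    · have : Nontrivial (FactorAEval F U y i) := by
        obtain ⟨u, hu, hu'⟩ := hlen.exists_notMem hi
        have h1 : factorMk F L U i ⟨u, hu⟩ ≠ 0 := fun h0 => hu' (factorMk_eq_zero.mp h0)
        exact ⟨Module.AEval'.of _ (factorMk F L U i ⟨u, hu⟩), 0, fun h0 =>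
          h1 ((LinearEquiv.map_eq_zero_iff _).mp h0)⟩
      obtain ⟨p, s, hps⟩ := exists_equiv_quotient_span_pow (F := F) (huni i hi)
      exact ⟨p, s, fun _ => hps⟩
    · exact ⟨0, 0, fun h => absurd h hi⟩
  choose p s hps using hfac
  have hstep : ∀ i, i + 1 < m → p (i + 1) = (p i).comp (X + C 1) ∧ s (i + 1) ≤ s i := by
    intro i hi
    obtain ⟨hm0, hi0, ⟨e0⟩⟩ := hps i (by omega)
    obtain ⟨hm1, hi1, ⟨e1⟩⟩ := hps (i + 1) hi
    obtain ⟨g, hg⟩ := exists_isFactorGenerator e0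
    obtain ⟨g', hg'⟩ := exists_isFactorGenerator e1
    exact hd.factor_succ hv1 (hvi i hi) hm0 hi0 hm1 hi1 hg hg'
  refine ⟨y, p, s, ?_, ?_, huni, fun i hi => (hps i hi).1, fun i hi => (hps i hi).2.1,
    fun i hi => (hps i hi).2.2, ?_, ?_⟩
  · exact Submodule.add_mem_sup (Submodule.smul_mem _ _ (Submodule.mem_span_singleton_self x)) hw'
  · intro hy0
    have h1 : y ∈ Submodule.span F {y} ⊓ a.toSubmodule :=
      ⟨Submodule.mem_span_singleton_self y, (mem_adEigenspace.mp hy0).1⟩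
    rw [hd.isCompl.inf_eq_bot] at h1
    exact hd.ne_zero h1
  · intro i
    induction i with
    | zero => intro _; simp
    | succ i ih =>
      intro hi
      rw [(hstep i hi).1, ih (by omega), comp_X_add_C_comp]
      push_cast
      rfl
  · intro i j hij
    induction j, hij using Nat.le_induction with
    | base => exact fun _ => le_rfl
    | succ j _ ih => exact fun hj => (hstep j hj).2.trans (ih (by omega))

end Existence

/-! ### Weights of `𝔞` and their multiplicities -/

section Weights

/-- If `V` is a cyclic `F[X]`-module with `X` acting as `T`, then the kernel of `f(T)` has dimension
at most `deg f`: it has the same dimension as the cokernel, a quotient of `F[X]/(f)`. -/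
theorem finrank_ker_aeval_le {F V : Type*} [Field F] [AddCommGroup V] [Module F V]
    [FiniteDimensional F V] {T : Module.End F V} {g : V} (hg : ∀ u, ∃ q : F[X], u = aeval T q g)
    {f : F[X]} (hf : f.Monic) :
    Module.finrank F (LinearMap.ker (aeval T f)) ≤ f.natDegree := by
  have h1 := LinearMap.finrank_range_add_finrank_ker (aeval T f)
  have h2 := Submodule.finrank_quotient_add_finrank (LinearMap.range (aeval T f))
  let φ : degreeLT F f.natDegree →ₗ[F] V ⧸ LinearMap.range (aeval T f) :=
    (LinearMap.range (aeval T f)).mkQ ∘ₗ (LinearMap.applyₗ g) ∘ₗ (aeval T).toLinearMap ∘ₗ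
      (degreeLT F f.natDegree).subtype
  have hφ : Function.Surjective φ := by
    intro w
    obtain ⟨u, rfl⟩ := Submodule.mkQ_surjective _ w
    obtain ⟨q, rfl⟩ := hg u
    refine ⟨⟨q %ₘ f, ?_⟩, ?_⟩
    · rw [mem_degreeLT, ← degree_eq_natDegree hf.ne_zero]
      exact degree_modByMonic_lt q hf
    · change Submodule.Quotient.mk (aeval T (q %ₘ f) g) = Submodule.Quotient.mk (aeval T q g)
      rw [Submodule.Quotient.eq, modByMonic_eq_sub_mul_div q, map_sub, LinearMap.sub_apply,
        map_mul, Module.End.mul_apply, sub_sub_cancel_left]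
      exact Submodule.neg_mem _ ⟨_, rfl⟩
  have : FiniteDimensional F (degreeLT F f.natDegree) :=
    Module.Finite.equiv (degreeLTEquiv F f.natDegree).symm
  have h3 := LinearMap.finrank_le_finrank_of_surjective hφ
  rw [(degreeLTEquiv F f.natDegree).finrank_eq, Module.finrank_fin_fun] at h3
  omega

variable {F : Type*} [Field F] {L : Type*} [LieRing L] [LieAlgebra F L]

/-- Generators `g i` of the nilpotency factors of `U` as `F[X]`-modules, where `X` acts as `y`,
with annihilators `p(X + i) ^ s i`; moreover `0, …, m - 1` are distinct in `F` and no nontrivial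
shift fixes `p`. -/
structure IsFactorSystem (y : L) (a : LieIdeal F L) (U : Type*) [AddCommGroup U] [Module F U]
    [LieRingModule L U] [LieModule F L U] (m : ℕ) (p : F[X]) (s : ℕ → ℕ) (g : ℕ → U) : Prop where
  diag : IsDiagSemidirect y a
  one_lt : 1 < m
  length : IsNilpLength F L U m
  monic : p.Monic
  irreducible : Irreducible p
  generator : ∀ i < m, IsFactorGenerator y i (p.comp (X + C (i : F)) ^ s i) (g i)
  cast_inj : ∀ i j : ℕ, i < m → j < m → (i : F) = j → i = j
  stabilizer : ∀ γ : F, p.comp (X + C γ) = p → γ = 0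

variable {U : Type*} [AddCommGroup U] [Module F U] [LieRingModule L U] [LieModule F L U]
  {y : L} {a : LieIdeal F L} {m : ℕ} {p : F[X]} {s : ℕ → ℕ} {g : ℕ → U}

theorem mem_nilpSeries_zero {u : U} : u ∈ nilpSeries F L U 0 ↔ u = 0 := LieSubmodule.mem_bot u

theorem IsFactorSystem.comp_injective (h : IsFactorSystem y a U m p s g) {γ δ : F}
    (hγδ : p.comp (X + C γ) = p.comp (X + C δ)) : γ = δ := by
  have h1 := congrArg (fun q => q.comp (X + C (-δ))) hγδ
  simp only [comp_X_add_C_comp, add_neg_cancel, C_0, add_zero, comp_X] at h1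
  exact sub_eq_zero.mp (by rw [sub_eq_add_neg]; exact h.stabilizer _ h1)

/-- If a vector of weight `δ` in `𝔞` kills `U⁽ⁱ⁾` but not `U⁽ⁱ⁺¹⁾`, then it maps `U⁽ⁱ⁺¹⁾` into `U⁽¹⁾`
and comparing primary components forces `δ = i`. -/
theorem IsFactorSystem.weight_eq (h : IsFactorSystem y a U m p s g) {δ : F} {w : L}
    (hw : w ∈ adEigenspace y a δ) {i : ℕ} (hi : i < m)
    (hker : ∀ u ∈ nilpSeries F L U i, ⁅w, u⁆ = 0) {u : U} (hu : u ∈ nilpSeries F L U (i + 1))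
    (hwu : ⁅w, u⁆ ≠ 0) : δ = i := by
  have hwa := mem_adEigenspace.mp hw
  have h0 : 0 < m := by have := h.one_lt; omega
  have hmem : ⁅w, u⁆ ∈ nilpSeries F L U 1 :=
    h.diag.lie_mem_succ hwa.1 (fun u hu => mem_nilpSeries_zero.mpr (hker u hu)) hu
  have hq := (h.generator 0 h0).aeval_mem hmem
  have hp := (h.generator i hi).aeval_mem hu
  have key := comp_eq_of_lie_notMem hwa.2 (N := nilpSeries F L U 0) (monic_comp_X_add_C h.monic _)
    (irreducible_comp_X_add_C h.irreducible _) (monic_comp_X_add_C h.monic _)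
    (irreducible_comp_X_add_C h.irreducible _) (fun h0 => hwu (mem_nilpSeries_zero.mp h0))
    (mem_nilpSeries_zero.mpr (hker _ hp)) hq
  rw [comp_X_add_C_comp] at key
  have := h.comp_injective key
  rw [Nat.cast_zero, ← sub_eq_add_neg, sub_eq_zero] at this
  exact this.symm

theorem IsFactorSystem.exists_weight_eq [LieModule.IsFaithful F L U]
    (h : IsFactorSystem y a U m p s g) {δ : F} {w : L} (hw : w ∈ adEigenspace y a δ)
    (hw0 : w ≠ 0) : ∃ j : ℕ, j < m ∧ δ = j := by
  by_contra! hcon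
  have hker : ∀ i ≤ m, ∀ u ∈ nilpSeries F L U i, ⁅w, u⁆ = 0 := by
    intro i
    induction i with
    | zero => intro _ u hu; rw [mem_nilpSeries_zero.mp hu, lie_zero]
    | succ i ih =>
      intro hi u hu
      by_contra hwu
      exact hcon i hi (h.weight_eq hw hi (ih (by omega)) hu hwu)
  refine hw0 ((LieModule.isFaithful_iff' F L U).mp inferInstance w fun u => hker m le_rfl u ?_)
  rw [h.length.eq_top]
  trivial

theorem IsFactorSystem.lie_eq_zero_of_mem (h : IsFactorSystem y a U m p s g) {j : ℕ} (hj : j < m)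
    {w : L} (hw : w ∈ adEigenspace y a (j : F)) {u : U} (hu : u ∈ nilpSeries F L U j) :
    ⁅w, u⁆ = 0 := by
  have hker : ∀ i ≤ j, ∀ u ∈ nilpSeries F L U i, ⁅w, u⁆ = 0 := by
    intro i
    induction i with
    | zero => intro _ u hu; rw [mem_nilpSeries_zero.mp hu, lie_zero]
    | succ i ih =>
      intro hi u hu
      by_contra hwu
      have := h.cast_inj j i hj (by omega) (h.weight_eq hw (by omega) (ih (by omega)) hu hwu)
      omega
  exact hker j le_rfl u hu

/-- A vector of weight `j` in `𝔞` is determined by its action on the generator of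
`U⁽ʲ⁺¹⁾ / U⁽ʲ⁾`. -/
theorem IsFactorSystem.eq_zero_of_lie_generator [LieModule.IsFaithful F L U]
    (h : IsFactorSystem y a U m p s g) {j : ℕ} (hj : j < m) {w : L}
    (hw : w ∈ adEigenspace y a (j : F)) (hwg : ⁅w, g j⁆ = 0) : w = 0 := by
  have hker : ∀ i ≤ m, ∀ u ∈ nilpSeries F L U i, ⁅w, u⁆ = 0 := by
    intro i
    induction i with
    | zero => intro _ u hu; rw [mem_nilpSeries_zero.mp hu, lie_zero]
    | succ i ih =>
      intro hi u hu
      by_contra hwu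
      have hij := h.cast_inj j i hj hi (h.weight_eq hw hi (ih (by omega)) hu hwu)
      subst hij
      obtain ⟨q, hq⟩ := (h.generator j hi).exists_aeval_sub_mem u hu
      have h1 := ih (by omega) _ hq
      rw [lie_sub, lie_aeval_toEnd (mem_adEigenspace.mp hw).2, hwg, map_zero, sub_zero] at h1
      exact hwu h1
  refine (LieModule.isFaithful_iff' F L U).mp inferInstance w fun u => hker m le_rfl u ?_
  rw [h.length.eq_top]
  trivial

/-- The map `w ↦ w (g j)` embeds `𝔞(j)` into the kernel of `p(y) ^ s j` on `U⁽¹⁾`. -/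
theorem IsFactorSystem.finrank_le [LieModule.IsFaithful F L U] [FiniteDimensional F U]
    (h : IsFactorSystem y a U m p s g) {j : ℕ} (hj : j < m) :
    Module.finrank F (adEigenspace y a (j : F)) ≤ p.natDegree * s j := by
  have h0 : 0 < m := by have := h.one_lt; omega
  set T := LieModule.toEnd F L (nilpSeries F L U 1) y
  have hT : ∀ (q : F[X]) (u : nilpSeries F L U 1), ((aeval T q u : nilpSeries F L U 1) : U) =
      aeval (LieModule.toEnd F L U y) q (u : U) := fun q u =>
    map_aeval_of_intertwines (nilpSeries F L U 1).incl.toLinearMap (fun u => rfl) q u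
  have hgen : ∀ u : nilpSeries F L U 1, ∃ q : F[X],
      u = aeval T q ⟨g 0, (h.generator 0 h0).mem⟩ := by
    intro u
    obtain ⟨q, hq⟩ := (h.generator 0 h0).exists_aeval_sub_mem u u.2
    refine ⟨q, Subtype.ext ?_⟩
    rw [hT]
    exact sub_eq_zero.mp (mem_nilpSeries_zero.mp hq)
  have hmem : ∀ w ∈ adEigenspace y a (j : F), ⁅w, g j⁆ ∈ nilpSeries F L U 1 := fun w hw =>
    h.diag.lie_mem_succ (mem_adEigenspace.mp hw).1
      (fun u hu => mem_nilpSeries_zero.mpr (h.lie_eq_zero_of_mem hj hw hu)) (h.generator j hj).mem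
  let φ : adEigenspace y a (j : F) →ₗ[F] LinearMap.ker (aeval T (p ^ s j)) :=
    { toFun := fun w => ⟨⟨⁅(w : L), g j⁆, hmem w w.2⟩, by
        rw [LinearMap.mem_ker]
        refine Subtype.ext ?_
        rw [hT]
        have h1 : ⁅(w : L), aeval (LieModule.toEnd F L U y)
            (p.comp (X + C (j : F)) ^ s j) (g j)⁆ = 0 :=
          h.lie_eq_zero_of_mem hj w.2 ((h.generator j hj).aeval_mem (h.generator j hj).mem)
        rw [lie_aeval_toEnd (mem_adEigenspace.mp w.2).2, pow_comp, comp_X_add_C_comp,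
          add_neg_cancel, C_0, add_zero, comp_X] at h1
        exact h1⟩
      map_add' := fun w w' => by ext; simp
      map_smul' := fun c w => by ext; simp }
  have hφ : Function.Injective φ := by
    rw [← LinearMap.ker_eq_bot, eq_bot_iff]
    intro w hw
    have h1 : ⁅(w : L), g j⁆ = 0 :=
      congrArg (fun u : LinearMap.ker (aeval T (p ^ s j)) => ((u : nilpSeries F L U 1) : U))
        (LinearMap.mem_ker.mp hw)
    exact Subtype.ext (h.eq_zero_of_lie_generator hj w.2 h1)
  have h1 := LinearMap.finrank_le_finrank_of_injective hφ
  have h2 := finrank_ker_aeval_le hgen (h.monic.pow (s j))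
  rw [natDegree_pow, mul_comm] at h2
  exact h1.trans h2

end Weights

/-! ### Uniserial modules with one-dimensional weights -/

section UniserialModule

variable {F : Type*} [Field F] {L : Type*} [LieRing L] [LieAlgebra F L]
  {U : Type*} [AddCommGroup U] [Module F U] [LieRingModule L U] [LieModule F L U]
  {y : L} {a : LieIdeal F L} {m : ℕ} {α : F} {s : ℕ → ℕ} {g : ℕ → U}

theorem aeval_X_sub_C_comp (u : U) (γ : F) :
    aeval (LieModule.toEnd F L U y) ((X - C α).comp (X + C γ)) u = ⁅y, u⁆ - (α - γ) • u := by
  simp only [sub_comp, X_comp, C_comp, map_sub, map_add, aeval_X, aeval_C, LinearMap.sub_apply,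
    LinearMap.add_apply, LieModule.toEnd_apply_apply, Module.algebraMap_end_apply, sub_smul]
  abel

theorem isCoprime_X_sub_C_comp {γ δ : F} (hγδ : γ ≠ δ) :
    IsCoprime ((X - C α).comp (X + C γ)) ((X - C α).comp (X + C δ)) := by
  have h1 : ∀ γ : F, (X - C α).comp (X + C γ) = X - C (α - γ) := fun γ => by
    simp only [sub_comp, X_comp, C_comp, C_sub]; ring
  rw [h1, h1]
  refine isCoprime_X_sub_C_of_isUnit_sub (IsUnit.mk0 _ ?_)
  intro h0
  apply hγδ
  linear_combination -h0

theorem IsFactorSystem.generator_notMem {p : F[X]} (h : IsFactorSystem y a U m p s g) {i : ℕ}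
    (hi : i < m) : g i ∉ nilpSeries F L U i := by
  intro hg
  obtain ⟨u, hu, hu'⟩ := h.length.exists_notMem hi
  obtain ⟨q, hq⟩ := (h.generator i hi).exists_aeval_sub_mem u hu
  exact hu' ((Submodule.sub_mem_iff_left (nilpSeries F L U i).toSubmodule
    (aeval_toEnd_mem _ y q hg)).mp hq)

theorem IsFactorSystem.exponent_ne_zero {p : F[X]} (h : IsFactorSystem y a U m p s g) {i : ℕ}
    (hi : i < m) : s i ≠ 0 := by
  intro h0
  apply h.generator_notMem hi
  have := (h.generator i hi).aeval_mem_iff 1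
  rw [h0, pow_zero] at this
  simpa using this

/-- Each step of the nilpotency series contains a new eigenvector of `y`. -/
theorem IsFactorSystem.exists_eigenvector (h : IsFactorSystem y a U m (X - C α) s g) {i : ℕ}
    (hi : i < m) : ∃ e ∈ nilpSeries F L U (i + 1), e ∉ nilpSeries F L U i ∧
      ⁅y, e⁆ = (α - i) • e := by
  set Y := LieModule.toEnd F L U y
  set f : ℕ → F[X] := fun i => (X - C α).comp (X + C (i : F))
  have hgi := h.generator i hi
  obtain ⟨k, hk⟩ := Nat.exists_eq_succ_of_ne_zero (h.exponent_ne_zero hi)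
  -- the product of the annihilators of the lower factors kills `U⁽ⁱ⁾`
  have hkill : ∀ n ≤ i, ∀ u ∈ nilpSeries F L U n,
      aeval Y (∏ l ∈ Finset.range n, f l ^ s l) u = 0 := by
    intro n
    induction n with
    | zero => intro _ u hu; rw [mem_nilpSeries_zero.mp hu, map_zero]
    | succ n ih =>
      intro hn u hu
      rw [Finset.prod_range_succ, map_mul, Module.End.mul_apply]
      exact ih (by omega) _ ((h.generator n (by omega)).aeval_mem hu)
  set P := ∏ l ∈ Finset.range i, f l ^ s l
  have hco : IsCoprime P (f i) := by
    refine IsCoprime.prod_left fun l hl => IsCoprime.pow_left (isCoprime_X_sub_C_comp fun h0 => ?_)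
    rw [Finset.mem_range] at hl
    have := h.cast_inj l i (by omega) hi h0
    omega
  set u := aeval Y (f i ^ k) (g i) with hu
  have hu1 : u ∈ nilpSeries F L U (i + 1) := aeval_toEnd_mem _ y _ hgi.mem
  have hirr : Irreducible (f i) := irreducible_comp_X_add_C h.irreducible _
  have hu2 : u ∉ nilpSeries F L U i := by
    rw [hu, hgi.aeval_mem_iff, pow_dvd_pow_iff hirr.ne_zero hirr.not_isUnit, hk]
    omega
  have hu3 : aeval Y (f i) u ∈ nilpSeries F L U i := by
    rw [hu, ← Module.End.mul_apply, ← map_mul, hgi.aeval_mem_iff, ← pow_succ', hk]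
  refine ⟨aeval Y P u, aeval_toEnd_mem _ y _ hu1, fun hmem => hu2 ?_, ?_⟩
  · exact mem_of_isCoprime (T := Y) (N := (nilpSeries F L U i).toSubmodule)
      (fun _ h => LieSubmodule.lie_mem _ h) hco hmem hu3
  · rw [← sub_eq_zero, ← aeval_X_sub_C_comp, ← Module.End.mul_apply, ← map_mul, mul_comm,
      map_mul, Module.End.mul_apply]
    exact hkill i le_rfl _ hu3

theorem lie_lie_eq_smul {u : U} {z : L} {δ μ : F} (hz : ⁅y, z⁆ = δ • z) (hu : ⁅y, u⁆ = μ • u) :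
    ⁅y, ⁅z, u⁆⁆ = (μ + δ) • ⁅z, u⁆ := by
  rw [leibniz_lie, hz, hu, smul_lie, lie_smul, add_smul, add_comm]

/-- In a uniserial module, `y` acts on `U⁽¹⁾` as the scalar `α`: the `y`-eigenvectors in `U⁽²⁾`
of eigenvalue `α - 1` together with those in `U⁽¹⁾` of eigenvalue `α` form a submodule not
contained in `U⁽¹⁾`, and this submodule must contain `U⁽¹⁾`. -/
theorem IsFactorSystem.lie_eq_smul (h : IsFactorSystem y a U m (X - C α) s g)
    (huni : IsUniserial F L U) {u : U} (hu : u ∈ nilpSeries F L U 1) : ⁅y, u⁆ = α • u := by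
  have h0 : 0 < m := by have := h.one_lt; omega
  let E : Submodule F U := (nilpSeries F L U 2).toSubmodule ⊓
    Module.End.eigenspace (LieModule.toEnd F L U y) (α - 1)
  let T : Submodule F U := (nilpSeries F L U 1).toSubmodule ⊓
    Module.End.eigenspace (LieModule.toEnd F L U y) α
  have hE : ∀ u, u ∈ E ↔ u ∈ nilpSeries F L U 2 ∧ ⁅y, u⁆ = (α - 1) • u := fun u => by
    simp [E, Submodule.mem_inf]
  have hT : ∀ u, u ∈ T ↔ u ∈ nilpSeries F L U 1 ∧ ⁅y, u⁆ = α • u := fun u => by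
    simp [T, Submodule.mem_inf]
  have hweight : ∀ δ, ∀ z ∈ adEigenspace y a δ, ∀ u ∈ E ⊔ T, ⁅z, u⁆ ∈ E ⊔ T := by
    intro δ z hz u hu
    obtain ⟨e, he, t, ht, rfl⟩ := Submodule.mem_sup.mp hu
    rw [hE] at he
    rw [hT] at ht
    have hz' := (mem_adEigenspace.mp hz).2
    have hez := lie_lie_eq_smul (u := e) hz' he.2
    have htz := lie_lie_eq_smul (u := t) hz' ht.2
    rw [lie_add]
    rcases eq_or_ne δ 0 with rfl | hδ
    · rw [add_zero] at hez htz
      exact Submodule.add_mem_sup ((hE _).mpr ⟨LieSubmodule.lie_mem _ he.1, hez⟩)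
        ((hT _).mpr ⟨LieSubmodule.lie_mem _ ht.1, htz⟩)
    · have hzn := h.diag.mem_nilRad hδ hz
      have hker : ∀ u ∈ nilpSeries F L U 1, ⁅z, u⁆ = 0 := fun u hu =>
        mem_nilpSeries_zero.mp (hu z hzn)
      rw [hker t ht.1, add_zero]
      by_cases hze : ⁅z, e⁆ = 0
      · rw [hze]; exact Submodule.zero_mem _
      · have hδ1 := h.weight_eq hz h.one_lt hker he.1 hze
        rw [hδ1, Nat.cast_one, sub_add_cancel] at hez
        exact Submodule.mem_sup_right ((hT _).mpr ⟨he.1 z hzn, hez⟩)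
  let D : LieSubmodule F L U :=
    { E ⊔ T with
      lie_mem := fun {z u} hu => by
        obtain ⟨c, w, hw, rfl⟩ := h.diag.exists_eq z
        rw [add_lie]
        refine Submodule.add_mem _ ?_ ?_
        · rw [smul_lie]
          refine Submodule.smul_mem _ _ ?_
          obtain ⟨e, he, t, ht, rfl⟩ := Submodule.mem_sup.mp hu
          rw [lie_add, ((hE e).mp he).2, ((hT t).mp ht).2]
          exact Submodule.add_mem_sup (E.smul_mem _ he) (T.smul_mem _ ht)
        · refine h.diag.induction (P := fun w => ⁅w, u⁆ ∈ E ⊔ T) ?_ ?_ ?_ hw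
          · simp
          · intro u t hu ht; rw [add_lie]; exact Submodule.add_mem _ hu ht
          · exact fun δ z hz => hweight δ z hz u hu }
  obtain ⟨e, he, he', hye⟩ := h.exists_eigenvector h.one_lt
  rw [Nat.cast_one] at hye
  have heD : e ∈ D := Submodule.mem_sup_left (S := E) ((hE e).mpr ⟨he, hye⟩)
  rcases huni D (nilpSeries F L U 1) with hle | hle
  · exact absurd (hle heD) he'
  · obtain ⟨e', he', t, ht, rfl⟩ := Submodule.mem_sup.mp (hle hu)
    rw [hE] at he'
    rw [hT] at ht
    have hmem : e' ∈ nilpSeries F L U 1 :=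
      (Submodule.add_mem_iff_left (nilpSeries F L U 1).toSubmodule ht.1).mp hu
    have hz : e' ∈ (⊥ : Submodule F U) := by
      refine mem_of_isCoprime (T := LieModule.toEnd F L U y) (N := ⊥)
        (fun u hu => by simp [(Submodule.mem_bot F).mp hu])
        (IsCoprime.pow_left (m := s 0) (isCoprime_X_sub_C_comp (α := α) (zero_ne_one (α := F)))) ?_ ?_
      · have := (h.generator 0 h0).aeval_mem hmem
        rw [Nat.cast_zero] at this
        exact mem_nilpSeries_zero.mp this
      · rw [aeval_X_sub_C_comp, he'.2, sub_self]; exact Submodule.zero_mem _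
    rw [(Submodule.mem_bot F).mp hz, zero_add]
    exact ht.2

theorem IsFactorSystem.exponent_zero_le_one (h : IsFactorSystem y a U m (X - C α) s g)
    (huni : IsUniserial F L U) : s 0 ≤ 1 := by
  have h0 : 0 < m := by have := h.one_lt; omega
  have hg := h.generator 0 h0
  have h1 : aeval (LieModule.toEnd F L U y) ((X - C α).comp (X + C ((0 : ℕ) : F))) (g 0) ∈
      nilpSeries F L U 0 := by
    rw [aeval_X_sub_C_comp, mem_nilpSeries_zero, h.lie_eq_smul huni hg.mem]
    simp
  rw [hg.aeval_mem_iff] at h1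
  have hirr : Irreducible ((X - C α).comp (X + C ((0 : ℕ) : F))) :=
    irreducible_comp_X_add_C h.irreducible _
  exact (pow_dvd_pow_iff hirr.ne_zero hirr.not_isUnit).mp (by rwa [pow_one])

/-- If `s i = 1`, then `U⁽ⁱ⁺¹⁾ / U⁽ⁱ⁾` is spanned by any of its nonzero vectors. -/
theorem IsFactorSystem.exists_sub_smul_mem (h : IsFactorSystem y a U m (X - C α) s g) {i : ℕ}
    (hi : i < m) (hs : s i = 1) {e u : U} (he : e ∈ nilpSeries F L U (i + 1))
    (he' : e ∉ nilpSeries F L U i) (hu : u ∈ nilpSeries F L U (i + 1)) :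
    ∃ c : F, u - c • e ∈ nilpSeries F L U i := by
  have hgi := h.generator i hi
  have key : ∀ u ∈ nilpSeries F L U (i + 1), ∃ c : F, u - c • g i ∈ nilpSeries F L U i := by
    intro u hu
    obtain ⟨q, hq⟩ := hgi.exists_aeval_sub_mem u hu
    refine ⟨q.eval (α - i), ?_⟩
    have h1 : aeval (LieModule.toEnd F L U y) (q - C (q.eval (α - i))) (g i) ∈
        nilpSeries F L U i := by
      rw [hgi.aeval_mem_iff, hs, pow_one]
      have : (X - C α).comp (X + C (i : F)) = X - C (α - i) := by
        simp only [sub_comp, X_comp, C_comp, C_sub]; ring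
      rw [this]
      exact X_sub_C_dvd_sub_C_eval
    have h2 := add_mem hq h1
    rw [map_sub, LinearMap.sub_apply, aeval_C, Module.algebraMap_end_apply, sub_add_sub_cancel]
      at h2
    exact h2
  obtain ⟨c, hc⟩ := key e he
  obtain ⟨d, hd⟩ := key u hu
  have hc0 : c ≠ 0 := by
    rintro rfl
    apply he'
    simpa using hc
  refine ⟨d * c⁻¹, ?_⟩
  have h1 := sub_mem hd ((nilpSeries F L U i).smul_mem (d * c⁻¹) hc)
  rw [smul_sub, smul_smul, mul_assoc, inv_mul_cancel₀ hc0, mul_one] at h1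
  have h2 : u - d • g i - ((d * c⁻¹) • e - d • g i) = u - (d * c⁻¹) • e := by abel
  rwa [h2] at h1

/-- A basis of `U` consisting of `y`-eigenvectors which are shifted by a vector `v` of weight
one. -/
theorem IsFactorSystem.exists_basis (h : IsFactorSystem y a U m (X - C α) s g)
    (hs : ∀ i < m, s i = 1) :
    ∃ (b : Module.Basis (Fin m) F U) (v : L), v ∈ adEigenspace y a 1 ∧
      (∀ i, ⁅y, b i⁆ = (α - ((i : ℕ) : F)) • b i) ∧
      (∀ i j : Fin m, (j : ℕ) = i + 1 → ⁅v, b j⁆ = b i) ∧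
      ∀ j : Fin m, (j : ℕ) = 0 → ⁅v, b j⁆ = 0 := by
  obtain ⟨δ, hδ, v, hv, hvi⟩ := h.diag.exists_weight_forall h.one_lt h.length
  have hvn := h.diag.mem_nilRad hδ hv
  have hδ1 : δ = 1 := by
    obtain ⟨u, hu, hvu⟩ := hvi 0 h.one_lt
    have := h.weight_eq hv h.one_lt (fun u hu => mem_nilpSeries_zero.mp (hu v hvn)) hu
      (fun h0 => hvu (mem_nilpSeries_zero.mpr h0))
    rw [this, Nat.cast_one]
  subst hδ1
  have hstep : ∀ i, i + 1 < m → ∀ e ∈ nilpSeries F L U (i + 2), e ∉ nilpSeries F L U (i + 1) →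
      ⁅v, e⁆ ∉ nilpSeries F L U i := by
    intro i hi e he he' hve
    obtain ⟨u, hu, hvu⟩ := hvi i hi
    obtain ⟨c, hc⟩ := h.exists_sub_smul_mem hi (hs _ hi) he he' hu
    apply hvu
    have h1 := hc v hvn
    rw [lie_sub, lie_smul] at h1
    exact (Submodule.sub_mem_iff_left (nilpSeries F L U i).toSubmodule
      ((nilpSeries F L U i).smul_mem c hve)).mp h1
  obtain ⟨n, rfl⟩ : ∃ n, m = n + 1 := ⟨m - 1, by have := h.one_lt; omega⟩
  obtain ⟨e, he, he', hye⟩ := h.exists_eigenvector (i := n) (by omega)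
  set V := LieModule.toEnd F L U v with hV
  have hE : ∀ k ≤ n, (V ^ k) e ∈ nilpSeries F L U (n - k + 1) ∧
      (V ^ k) e ∉ nilpSeries F L U (n - k) ∧ ⁅y, (V ^ k) e⁆ = (α - n + k) • (V ^ k) e := by
    intro k
    induction k with
    | zero => intro _; simpa using ⟨he, he', hye⟩
    | succ k ih =>
      intro hk
      obtain ⟨h1, h2, h3⟩ := ih (by omega)
      obtain ⟨l, hl⟩ : ∃ l, n - k = l + 1 := ⟨n - k - 1, by omega⟩
      rw [hl] at h1 h2
      rw [show n - (k + 1) = l by omega, pow_succ', Module.End.mul_apply]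
      refine ⟨h1 v hvn, hstep l (by omega) _ h1 h2, ?_⟩
      have := lie_lie_eq_smul (mem_adEigenspace.mp hv).2 h3
      rw [Nat.cast_succ, ← add_assoc]
      exact this
  set f : Fin (n + 1) → U := fun i => (V ^ (n - i)) e with hf
  have hfy : ∀ i, ⁅y, f i⁆ = (α - ((i : ℕ) : F)) • f i := by
    intro i
    rw [hf, (hE (n - i) (by omega)).2.2, Nat.cast_sub (by omega)]
    congr 1
    ring
  have hfm : ∀ i : Fin (n + 1), f i ∈ nilpSeries F L U (i + 1) ∧ f i ∉ nilpSeries F L U i := by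
    intro i
    have := hE (n - i) (by omega)
    rw [show n - (n - (i : ℕ)) = i by omega] at this
    exact ⟨this.1, this.2.1⟩
  have hli : LinearIndependent F f := by
    refine Module.End.eigenvectors_linearIndependent' (LieModule.toEnd F L U y)
      (fun i : Fin (n + 1) => α - ((i : ℕ) : F)) ?_ f fun i => ?_
    · intro i j hij
      exact Fin.ext (h.cast_inj i j i.2 j.2 (sub_right_injective hij))
    · rw [Module.End.hasEigenvector_iff, Module.End.mem_eigenspace_iff]
      refine ⟨hfy i, fun h0 => (hfm i).2 ?_⟩
      rw [h0]; exact zero_mem _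
  have hspan : ∀ i ≤ n + 1, ∀ u ∈ nilpSeries F L U i, u ∈ Submodule.span F (Set.range f) := by
    intro i
    induction i with
    | zero => intro _ u hu; rw [mem_nilpSeries_zero.mp hu]; exact zero_mem _
    | succ i ih =>
      intro hi u hu
      obtain ⟨h1, h2⟩ := hfm ⟨i, hi⟩
      obtain ⟨c, hc⟩ := h.exists_sub_smul_mem hi (hs i hi) h1 h2 hu
      have := add_mem (ih (by omega) _ hc)
        (Submodule.smul_mem _ c (Submodule.subset_span ⟨⟨i, hi⟩, rfl⟩))
      rwa [sub_add_cancel] at this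
  refine ⟨Module.Basis.mk hli fun u _ => hspan _ le_rfl u (by
    rw [h.length.eq_top]; trivial), v, hv, ?_, ?_, ?_⟩
  · intro i
    rw [Module.Basis.mk_apply, hfy]
  · intro i j hij
    rw [Module.Basis.mk_apply, Module.Basis.mk_apply]
    simp only [hf]
    rw [show n - (i : ℕ) = n - j + 1 by omega, pow_succ', Module.End.mul_apply]
    rfl
  · intro j hj
    rw [Module.Basis.mk_apply]
    have := (hfm j).1
    rw [hj] at this
    exact mem_nilpSeries_zero.mp (this v hvn)

end UniserialModule

/-! ### Normal bases and isomorphism invariants -/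

section NormalBasis

section LinearAlgebra

variable {F : Type*} [Field F] {U : Type*} [AddCommGroup U] [Module F U] {m : ℕ}
  {b : Module.Basis (Fin m) F U} {T V : Module.End F U} {α : F}

theorem toMatrix_eq_descMatrix_iff :
    LinearMap.toMatrix b b T = descMatrix m α ↔ ∀ i, T (b i) = (α - ((i : ℕ) : F)) • b i := by
  constructor
  · intro h i
    have hT : T = Matrix.toLin b b (descMatrix m α) := by rw [← h, Matrix.toLin_toMatrix]
    rw [hT, Matrix.toLin_self, Finset.sum_eq_single i]
    · simp [descMatrix]
    · intro j _ hj; simp [descMatrix, Matrix.diagonal_apply_ne _ hj]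
    · simp
  · intro h
    ext i j
    rw [LinearMap.toMatrix_apply, h, map_smul, b.repr_self, Finsupp.smul_single, descMatrix,
      Matrix.diagonal_apply, Finsupp.single_apply, smul_eq_mul, mul_one]
    by_cases hij : i = j
    · simp [hij]
    · rw [if_neg hij, if_neg (Ne.symm hij)]

theorem toMatrix_eq_shiftMatrix_iff :
    LinearMap.toMatrix b b V = shiftMatrix F m ↔
      (∀ i j : Fin m, (j : ℕ) = i + 1 → V (b j) = b i) ∧
        ∀ j : Fin m, (j : ℕ) = 0 → V (b j) = 0 := by
  constructor
  · intro h
    have hV : V = Matrix.toLin b b (shiftMatrix F m) := by rw [← h, Matrix.toLin_toMatrix]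
    constructor
    · intro i j hij
      rw [hV, Matrix.toLin_self, Finset.sum_eq_single i]
      · simp [shiftMatrix, hij]
      · intro k _ hk
        have : (j : ℕ) ≠ k + 1 := fun h => hk (Fin.ext (by omega))
        simp [shiftMatrix, this]
      · simp
    · intro j hj
      rw [hV, Matrix.toLin_self, Finset.sum_eq_zero]
      intro k _
      simp [shiftMatrix, hj]
  · rintro ⟨h1, h2⟩
    ext i j
    rw [LinearMap.toMatrix_apply]
    rcases Nat.eq_zero_or_pos j with hj | hj
    · rw [h2 j hj]; simp [shiftMatrix, hj]
    · obtain ⟨k, hk⟩ : ∃ k : Fin m, (j : ℕ) = k + 1 := ⟨⟨j - 1, by omega⟩, by simp; omega⟩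
      rw [h1 k j hk, b.repr_self, Finsupp.single_apply]
      simp only [shiftMatrix, Matrix.of_apply, hk, Nat.add_right_cancel_iff, Fin.ext_iff]

theorem pow_shift_apply (h : ∀ i j : Fin m, (j : ℕ) = i + 1 → V (b j) = b i) (k : ℕ)
    (i j : Fin m) (hij : (j : ℕ) = i + k) : (V ^ k) (b j) = b i := by
  induction k generalizing i with
  | zero => rw [pow_zero, Module.End.one_apply]; congr 1; exact Fin.ext hij
  | succ k ih =>
    rw [pow_succ', Module.End.mul_apply, ih ⟨i + 1, by omega⟩ (by simp; omega)]
    exact h _ _ rfl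

theorem ker_shift (h : ∀ i j : Fin m, (j : ℕ) = i + 1 → V (b j) = b i)
    (h0 : ∀ j : Fin m, (j : ℕ) = 0 → V (b j) = 0) {z : Fin m} (hz : (z : ℕ) = 0) {u : U}
    (hu : V u = 0) : u = b.repr u z • b z := by
  have hsum : ∑ j, b.repr u j • V (b j) = 0 := by
    rw [← hu]
    conv_rhs => rw [← b.sum_repr u, map_sum]
    simp
  have hcoord : ∀ j : Fin m, (j : ℕ) ≠ 0 → b.repr u j = 0 := by
    intro j hj
    obtain ⟨i, hi⟩ : ∃ i : Fin m, (j : ℕ) = i + 1 := ⟨⟨j - 1, by omega⟩, by simp; omega⟩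
    have h1 := congrArg (fun w => b.repr w i) hsum
    simp only [map_sum, map_smul, Finsupp.coe_finsetSum, Finset.sum_apply, map_zero,
      Finsupp.coe_zero, Pi.zero_apply, Finsupp.smul_apply] at h1
    rw [Finset.sum_eq_single j] at h1
    · rw [h i j hi] at h1
      simpa using h1
    · intro k _ hk
      rcases Nat.eq_zero_or_pos k with hk0 | hk0
      · rw [h0 k hk0]; simp
      · obtain ⟨l, hl⟩ : ∃ l : Fin m, (k : ℕ) = l + 1 := ⟨⟨k - 1, by omega⟩, by simp; omega⟩
        rw [h l k hl, b.repr_self, Finsupp.single_eq_of_ne, smul_zero]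
        intro he
        apply hk
        apply Fin.ext
        rw [hl, hi, he]
    · simp
  conv_lhs => rw [← b.sum_repr u]
  rw [Finset.sum_eq_single z]
  · intro j _ hj
    rw [hcoord j (fun h => hj (Fin.ext (by omega))), zero_smul]
  · simp

theorem eigenvector_eq_smul (hT : ∀ i, T (b i) = (α - ((i : ℕ) : F)) • b i)
    (hinj : ∀ i j : ℕ, i < m → j < m → (i : F) = j → i = j) (k : Fin m) {u : U}
    (hu : T u = (α - ((k : ℕ) : F)) • u) : u = b.repr u k • b k := by
  conv_lhs => rw [← b.sum_repr u]
  rw [Finset.sum_eq_single k]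
  · intro j _ hj
    have h1 : b.repr (T u) j = (α - ((j : ℕ) : F)) * b.repr u j := by
      conv_lhs => rw [← b.sum_repr u, map_sum]
      simp only [map_smul, hT, map_sum, Finsupp.coe_finsetSum, Finset.sum_apply,
        Finsupp.smul_apply, b.repr_self, smul_eq_mul]
      rw [Finset.sum_eq_single j]
      · simp [mul_comm]
      · intro l _ hl; simp [hl]
      · simp
    rw [hu, map_smul, Finsupp.smul_apply, smul_eq_mul] at h1
    have h2 : (((j : ℕ) : F) - ((k : ℕ) : F)) * b.repr u j = 0 := by linear_combination h1
    rcases mul_eq_zero.mp h2 with h3 | h3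
    · exact absurd (Fin.ext (hinj j k j.2 k.2 (sub_eq_zero.mp h3))) hj
    · rw [h3, zero_smul]
  · simp

theorem equiv_apply_of_toMatrix_eq {U' : Type*} [AddCommGroup U'] [Module F U']
    {b' : Module.Basis (Fin m) F U'} {T' : Module.End F U'}
    (h : LinearMap.toMatrix b b T = LinearMap.toMatrix b' b' T') (u : U) :
    b.equiv b' (Equiv.refl _) (T u) = T' (b.equiv b' (Equiv.refl _) u) := by
  have : (b.equiv b' (Equiv.refl _)).toLinearMap ∘ₗ T =
      T' ∘ₗ (b.equiv b' (Equiv.refl _)).toLinearMap := by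
    refine b.ext fun i => ?_
    simp only [LinearMap.comp_apply, LinearEquiv.coe_coe, Module.Basis.equiv_apply, Equiv.refl_apply]
    have hT : T = Matrix.toLin b b (LinearMap.toMatrix b b T) := by rw [Matrix.toLin_toMatrix]
    have hT' : T' = Matrix.toLin b' b' (LinearMap.toMatrix b b T) := by
      rw [h, Matrix.toLin_toMatrix]
    rw [hT', hT, Matrix.toLin_self, LinearMap.toMatrix_toLin, Matrix.toLin_self, map_sum]
    simp
  exact LinearMap.congr_fun this u

end LinearAlgebra

variable {F : Type*} [Field F] {L : Type*} [LieRing L] [LieAlgebra F L]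
  {U : Type*} [AddCommGroup U] [Module F U] [LieRingModule L U] [LieModule F L U]
  {y v : L} {a : LieIdeal F L} {m : ℕ} {α : F} {b : Module.Basis (Fin m) F U}

/-- An element of `𝔞` of weight `j` commutes with the shift `v`, hence is determined by its value
on the last basis vector, so it acts as a multiple of `v ^ j`. -/
theorem IsDiagSemidirect.exists_toEnd_eq_smul_pow (h : IsDiagSemidirect y a) (hv : v ∈ a)
    (hinj : ∀ i j : ℕ, i < m → j < m → (i : F) = j → i = j)
    (hy : ∀ i, ⁅y, b i⁆ = (α - ((i : ℕ) : F)) • b i)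
    (hvb : ∀ i j : Fin m, (j : ℕ) = i + 1 → ⁅v, b j⁆ = b i) {j : ℕ} (hj : j < m) {w : L}
    (hw : w ∈ adEigenspace y a (j : F)) :
    ∃ β : F, LieModule.toEnd F L U w = β • LieModule.toEnd F L U v ^ j := by
  obtain ⟨n, rfl⟩ : ∃ n, m = n + 1 := ⟨m - 1, by omega⟩
  set V := LieModule.toEnd F L U v
  have hwa := mem_adEigenspace.mp hw
  have hVb : ∀ i j : Fin (n + 1), (j : ℕ) = i + 1 → V (b j) = b i := hvb
  have h1 : ⁅y, ⁅w, b (Fin.last n)⁆⁆ = (α - ((n - j : ℕ) : F)) • ⁅w, b (Fin.last n)⁆ := by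
    rw [lie_lie_eq_smul hwa.2 (hy _), Fin.val_last, Nat.cast_sub (by omega)]
    congr 1
    ring
  have h2 := eigenvector_eq_smul (T := LieModule.toEnd F L U y) hy hinj ⟨n - j, by omega⟩ h1
  set β := b.repr ⁅w, b (Fin.last n)⁆ ⟨n - j, by omega⟩
  refine ⟨β, b.ext fun i => ?_⟩
  have hcomm : Commute (LieModule.toEnd F L U w) V := by
    refine LinearMap.ext fun u => ?_
    exact h.lie_lie_comm hwa.1 hv u
  have hi : b i = (V ^ (n - (i : ℕ))) (b (Fin.last n)) :=
    (pow_shift_apply hVb _ _ _ (by rw [Fin.val_last]; omega)).symm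
  have hlast : (V ^ j) (b (Fin.last n)) = b ⟨n - j, by omega⟩ :=
    pow_shift_apply hVb _ _ _ (by rw [Fin.val_last]; simp; omega)
  rw [hi, ← Module.End.mul_apply, (hcomm.pow_right _).eq, Module.End.mul_apply,
    LieModule.toEnd_apply_apply, h2, ← hlast, map_smul, LinearMap.smul_apply,
    ← Module.End.mul_apply, ← Module.End.mul_apply, ← pow_add, ← pow_add, add_comm]

theorem IsNormalBasis.toMatrix_one {S : Set F} {h1 : (1 : F) ∈ S} {w : S → L} {β : S → F}
    (hb : IsNormalBasis y w b α β) (hm : 1 < m)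
    (hinj : ∀ i j : ℕ, i < m → j < m → (i : F) = j → i = j) (hβ : β ⟨1, h1⟩ = 1) :
    LinearMap.toMatrix b b (LieModule.toEnd F L U (w ⟨1, h1⟩)) = shiftMatrix F m := by
  obtain ⟨j, hj, hj1, hM⟩ := hb.shift ⟨1, h1⟩
  have : j = 1 := hinj j 1 hj hm (by rw [← hj1, Nat.cast_one])
  rw [hM, hβ, this, one_smul, pow_one]

/-- Two modules with normal bases are isomorphic exactly when their size, leading eigenvalue and
coefficients agree. -/
theorem IsNormalBasis.nonempty_equiv_iff {S : Set F} {h1 : (1 : F) ∈ S} (h : IsDiagSemidirect y a)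
    (hm : 1 < m) (hinj : ∀ i j : ℕ, i < m → j < m → (i : F) = j → i = j)
    {e : Module.Basis S F a} {β : S → F} (hβ : β ⟨1, h1⟩ = 1)
    (hb : IsNormalBasis y (fun δ => (e δ : L)) b α β)
    {U' : Type*} [AddCommGroup U'] [Module F U'] [LieRingModule L U'] [LieModule F L U'] {m' : ℕ}
    {b' : Module.Basis (Fin m') F U'} {α' : F} {β' : S → F} (hβ' : β' ⟨1, h1⟩ = 1)
    (hb' : IsNormalBasis y (fun δ => (e δ : L)) b' α' β') :
    Nonempty (U ≃ₗ⁅F,L⁆ U') ↔ m = m' ∧ α = α' ∧ β = β' := by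
  constructor
  · rintro ⟨f⟩
    have hf : ∀ (z : L) (u : U), f ⁅z, u⁆ = ⁅z, f u⁆ := fun z u => f.toLieModuleHom.map_lie z u
    have hmm : m = m' := by
      have := f.toLinearEquiv.finrank_eq
      rwa [Module.finrank_eq_card_basis b, Module.finrank_eq_card_basis b', Fintype.card_fin,
        Fintype.card_fin] at this
    subst hmm
    have hN := hb.toMatrix_one hm hinj hβ
    have hN' := hb'.toMatrix_one hm hinj hβ'
    obtain ⟨hs, hs0⟩ := toMatrix_eq_shiftMatrix_iff.mp hN
    obtain ⟨hs', hs0'⟩ := toMatrix_eq_shiftMatrix_iff.mp hN'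
    have hy := toMatrix_eq_descMatrix_iff.mp hb.diag
    have hy' := toMatrix_eq_descMatrix_iff.mp hb'.diag
    let z : Fin m := ⟨0, by omega⟩
    have hfz0 : f (b z) ≠ 0 := by
      rw [ne_eq, ← f.map_zero]
      exact fun h => b.ne_zero z (f.injective h)
    -- the kernel of the shift is a line on which `y` acts as the leading eigenvalue
    have hfz : f (b z) = b'.repr (f (b z)) z • b' z := by
      refine ker_shift hs' hs0' rfl ?_
      have := hs0 z rfl
      rw [LieModule.toEnd_apply_apply] at this ⊢
      rw [← hf, this, map_zero]
    refine ⟨rfl, ?_, ?_⟩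
    · have h2 : ⁅y, f (b z)⁆ = α • f (b z) := by
        have := hy z
        rw [LieModule.toEnd_apply_apply] at this
        rw [← hf, this]
        simp [z]
      have h3 : ⁅y, f (b z)⁆ = α' • f (b z) := by
        have := hy' z
        rw [LieModule.toEnd_apply_apply] at this
        have hz : α' - ((z : ℕ) : F) = α' := by simp [z]
        rw [hfz, lie_smul, this, hz, smul_comm]
      exact smul_left_injective F hfz0 (h2.symm.trans h3)
    · funext δ
      obtain ⟨j, hj, hjδ, hM⟩ := hb.shift δ
      obtain ⟨k, hk, hkδ, hM'⟩ := hb'.shift δ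
      have hjk : j = k := hinj j k hj hk (hjδ.symm.trans hkδ)
      subst hjk
      set V := LieModule.toEnd F L U (e ⟨1, h1⟩ : L) with hV
      set V' := LieModule.toEnd F L U' (e ⟨1, h1⟩ : L) with hV'
      have hW : LieModule.toEnd F L U (e δ : L) = β δ • V ^ j := by
        apply (LinearMap.toMatrix b b).injective
        rw [hM, map_smul, ← LinearMap.toMatrix_pow, hN]
      have hW' : LieModule.toEnd F L U' (e δ : L) = β' δ • V' ^ j := by
        apply (LinearMap.toMatrix b' b').injective
        rw [hM', map_smul, ← LinearMap.toMatrix_pow, hN']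
      have hfV : ∀ k : ℕ, ∀ u, f ((V ^ k) u) = (V' ^ k) (f u) := by
        intro k
        induction k with
        | zero => simp
        | succ k ih =>
          intro u
          rw [pow_succ, pow_succ, Module.End.mul_apply, Module.End.mul_apply, ih]
          congr 1
          exact hf _ _
      have hz : (V ^ j) (b ⟨j, hj⟩) = b z := pow_shift_apply hs j z ⟨j, hj⟩ (by simp [z])
      have h2 : f ⁅(e δ : L), b ⟨j, hj⟩⁆ = β δ • f (b z) := by
        have := LinearMap.congr_fun hW (b ⟨j, hj⟩)
        rw [LieModule.toEnd_apply_apply] at this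
        rw [this, LinearMap.smul_apply, hz, map_smul]
      have h3 : f ⁅(e δ : L), b ⟨j, hj⟩⁆ = β' δ • f (b z) := by
        have := LinearMap.congr_fun hW' (f (b ⟨j, hj⟩))
        rw [LieModule.toEnd_apply_apply] at this
        rw [hf, this, LinearMap.smul_apply, ← hfV, hz]
      exact smul_left_injective F hfz0 (h2.symm.trans h3)
  · rintro ⟨rfl, rfl, rfl⟩
    have hwδ : ∀ (δ : S) (u : U), b.equiv b' (Equiv.refl _) ⁅(e δ : L), u⁆ =
        ⁅(e δ : L), b.equiv b' (Equiv.refl _) u⁆ := by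
      intro δ u
      obtain ⟨j, hj, hjδ, hM⟩ := hb.shift δ
      obtain ⟨k, hk, hkδ, hM'⟩ := hb'.shift δ
      have hjk : j = k := hinj j k hj hk (hjδ.symm.trans hkδ)
      subst hjk
      exact equiv_apply_of_toMatrix_eq (hM.trans hM'.symm) u
    refine ⟨{ b.equiv b' (Equiv.refl _) with map_lie' := fun {z u} => ?_ }⟩
    change b.equiv b' (Equiv.refl _) ⁅z, u⁆ = ⁅z, b.equiv b' (Equiv.refl _) u⁆
    obtain ⟨c, w, hw, rfl⟩ := h.exists_eq z
    have h2 : b.equiv b' (Equiv.refl _) ⁅y, u⁆ = ⁅y, b.equiv b' (Equiv.refl _) u⁆ :=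
      equiv_apply_of_toMatrix_eq (hb.diag.trans hb'.diag.symm) u
    have h3 : b.equiv b' (Equiv.refl _) ⁅w, u⁆ = ⁅w, b.equiv b' (Equiv.refl _) u⁆ := by
      have key : ∀ w : a, b.equiv b' (Equiv.refl _) ⁅(w : L), u⁆ =
          ⁅(w : L), b.equiv b' (Equiv.refl _) u⁆ := by
        intro w
        induction e.mem_span w using Submodule.span_induction with
        | mem w hw => obtain ⟨δ, rfl⟩ := hw; exact hwδ δ u
        | zero => simp
        | add w t _ _ hw ht => simp [add_lie, hw, ht]
        | smul c w _ hw => simp [smul_lie, hw]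
      exact key ⟨w, hw⟩
    rw [add_lie, add_lie, smul_lie, smul_lie, map_add, map_smul, h2, h3]

end NormalBasis

/-! ### Adapted data -/

section Adapted

variable {F : Type*} [Field F] {L : Type*} [LieRing L] [LieAlgebra F L]
  {U : Type*} [AddCommGroup U] [Module F U] [LieRingModule L U] [LieModule F L U]
  {x y : L} {a : LieIdeal F L} {m : ℕ} {p : ℕ → F[X]} {s : ℕ → ℕ}

theorem IsAdapted.exists_isFactorSystem (h : IsAdapted x a U m y p s) (hL : IsDiagSemidirect x a)
    (hm : 1 < m) (hlen : IsNilpLength F L U m)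
    (hchar : ∀ q : ℕ, q.Prime → CharP F q → m ≤ q ∧
      ∀ γ : F, (p 0).comp (X + C γ) = p 0 → γ = 0) :
    ∃ g : ℕ → U, IsFactorSystem y a U m (p 0) s g := by
  have h0 : 0 < m := by omega
  obtain ⟨c, hc, w, hw, rfl⟩ := exists_eq_smul_add_of_notMem h.mem h.notMem
  have hgen : ∀ i, ∃ g : U, i < m →
      IsFactorGenerator (c • x + w) i ((p 0).comp (X + C (i : F)) ^ s i) g := by
    intro i
    by_cases hi : i < m
    · obtain ⟨e⟩ := h.factor i hi
      obtain ⟨g, hg⟩ := exists_isFactorGenerator e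
      rw [h.shift i hi] at hg
      exact ⟨g, fun _ => hg⟩
    · exact ⟨0, fun h => absurd h hi⟩
  choose g hg using hgen
  obtain ⟨q, hq⟩ := CharP.exists F
  -- in characteristic zero both properties are automatic
  have hcases : (∀ i j : ℕ, i < m → j < m → (i : F) = j → i = j) ∧
      ∀ γ : F, (p 0).comp (X + C γ) = p 0 → γ = 0 := by
    rcases CharP.char_is_prime_or_zero F q with hprime | rfl
    · obtain ⟨hmq, hst⟩ := hchar q hprime hq
      exact ⟨fun i j hi hj hij => CharP.natCast_injOn_Iio F q (Set.mem_Iio.mpr (by omega))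
        (Set.mem_Iio.mpr (by omega)) hij, hst⟩
    · have : CharZero F := CharP.charP_to_charZero F
      exact ⟨fun i j _ _ hij => Nat.cast_injective hij, fun γ hγ =>
        eq_zero_of_comp_X_add_C_eq (h.irreducible 0 h0).natDegree_pos hγ⟩
  exact ⟨g, hL.replace hc hw, hm, hlen, h.monic 0 h0, h.irreducible 0 h0, hg, hcases.1, hcases.2⟩

end Adapted

end LinkedModules

theorem mainTheorem3 {F : Type*} [Field F]
    {L : Type*} [LieRing L] [LieAlgebra F L] [FiniteDimensional F L]
    (x : L) (a : LieIdeal F L) (hL : LinkedModules.IsDiagSemidirect x a)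
    (hF : (Infinite F ∧ PerfectField F) ∨ LinkedModules.adEigenspace x a 0 = ⊥)
    {U : Type*} [AddCommGroup U] [Module F U] [LieRingModule L U] [LieModule F L U]
    [FiniteDimensional F U]
    (hU : LinkedModules.IsLinked F L U)
    (m : ℕ) (hm : 1 < m) (hlen : LinkedModules.IsNilpLength F L U m)
    (hfaith : LieModule.IsFaithful F L U) :
    -- the element `y` and the data `p`, `s` exist
    (∃ (y : L) (p : ℕ → Polynomial F) (s : ℕ → ℕ), LinkedModules.IsAdapted x a U m y p s) ∧
    ∀ (y : L) (p : ℕ → Polynomial F) (s : ℕ → ℕ), LinkedModules.IsAdapted x a U m y p s →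
      -- in prime characteristic `q`: `q ≥ m` and the stabilizer of `p₁` is trivial
      (∀ q : ℕ, q.Prime → CharP F q → m ≤ q ∧
        ∀ γ : F, (p 0).comp (Polynomial.X + Polynomial.C γ) = p 0 → γ = 0) →
      -- eigenvalues of `ad y` on `𝔞` and their multiplicities
      (∀ δ : F, LinkedModules.adEigenspace y a δ ≠ ⊥ → ∃ j : ℕ, j < m ∧ δ = (j : F)) ∧
      (∀ j : ℕ, j < m →
        Module.finrank F (LinkedModules.adEigenspace y a (j : F)) ≤ (p 0).natDegree * s j) ∧
      -- the uniserial case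
      (LinkedModules.IsUniserial F L U →
        (IsAlgClosed F → ∃ α : F, p 0 = Polynomial.X - Polynomial.C α) ∧
        ∀ α : F, p 0 = Polynomial.X - Polynomial.C α →
          (∀ δ : F, LinkedModules.adEigenspace y a δ ≠ ⊥ →
            Module.finrank F (LinkedModules.adEigenspace y a δ) = 1) ∧
          ∃ (b : Module.Basis (Fin m) F U) (v : L)
            (h1 : (1 : F) ∈ LinkedModules.actingEigenvalues y a U),
            LinearMap.toMatrix b b (LieModule.toEnd F L U y) = LinkedModules.descMatrix m α ∧
            v ∈ LinkedModules.nilRad F L ∧ v ≠ 0 ∧ ⁅y, v⁆ = v ∧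
            LinearMap.toMatrix b b (LieModule.toEnd F L U v) = LinkedModules.shiftMatrix F m ∧
            -- any eigenbasis of `𝔞` with `v₁ = v`
            ∀ e : Module.Basis (LinkedModules.actingEigenvalues y a U) F a,
              (∀ δ, ⁅y, (e δ : L)⁆ = (δ : F) • (e δ : L)) → (e ⟨1, h1⟩ : L) = v →
              ∃ β : LinkedModules.actingEigenvalues y a U → F,
                (∀ δ, β δ ≠ 0) ∧ β ⟨1, h1⟩ = 1 ∧
                LinkedModules.IsNormalBasis y (fun δ => (e δ : L)) b α β ∧
                -- `m`, `α` and `β` form a complete set of isomorphism invariants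
                ∀ (U' : Type*) [AddCommGroup U'] [Module F U'] [LieRingModule L U']
                  [LieModule F L U'] (m' : ℕ) (b' : Module.Basis (Fin m') F U') (α' : F)
                  (β' : LinkedModules.actingEigenvalues y a U → F), β' ⟨1, h1⟩ = 1 →
                  LinkedModules.IsNormalBasis y (fun δ => (e δ : L)) b' α' β' →
                  (Nonempty (U ≃ₗ⁅F,L⁆ U') ↔ m = m' ∧ α = α' ∧ β = β')) := by
  refine ⟨LinkedModules.exists_isAdapted hL hF hU hm hlen, fun y p s had hchar => ?_⟩
  have h0 : 0 < m := by omega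
  obtain ⟨g, hsys⟩ := had.exists_isFactorSystem hL hm hlen hchar
  refine ⟨fun δ hδ => ?_, fun j hj => hsys.finrank_le hj, fun huni => ⟨fun hclosed => ?_, ?_⟩⟩
  · obtain ⟨w, hw, hw0⟩ := (Submodule.ne_bot_iff _).mp hδ
    exact hsys.exists_weight_eq hw hw0
  · have hdeg := IsAlgClosed.degree_eq_one_of_irreducible F (had.irreducible 0 h0)
    refine ⟨-(p 0).coeff 0, ?_⟩
    have := (had.monic 0 h0).eq_X_add_C (Polynomial.natDegree_eq_of_degree_eq_some hdeg)
    rw [Polynomial.C_neg, sub_neg_eq_add]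
    exact this
  intro α hα
  have hrank := fun (j : ℕ) (hj : j < m) => hsys.finrank_le hj
  rw [hα] at hsys
  rw [hα, Polynomial.natDegree_X_sub_C] at hrank
  have hs : ∀ i < m, s i = 1 := by
    intro i hi
    have h1 := hsys.exponent_zero_le_one huni
    have h2 := had.antitone 0 i (Nat.zero_le i) hi
    have h3 := hsys.exponent_ne_zero hi
    omega
  have hy := hsys.diag
  refine ⟨fun δ hδ => ?_, ?_⟩
  · obtain ⟨w, hw, hw0⟩ := (Submodule.ne_bot_iff _).mp hδ
    obtain ⟨j, hj, rfl⟩ := hsys.exists_weight_eq hw hw0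
    have h1 := hrank j hj
    rw [hs j hj] at h1
    have h2 := (Submodule.one_le_finrank_iff).mpr hδ
    omega
  obtain ⟨b, v, hv, hyb, hvb, hvb0⟩ := hsys.exists_basis hs
  have hvb1 : ⁅v, b ⟨1, hm⟩⁆ ≠ 0 := by
    rw [hvb ⟨0, h0⟩ ⟨1, hm⟩ rfl]
    exact b.ne_zero _
  have hv0 : v ≠ 0 := by
    rintro rfl
    exact hvb1 (zero_lie _)
  have hvy : ⁅y, v⁆ = v := by
    rw [(LinkedModules.mem_adEigenspace.mp hv).2, one_smul]
  have hdesc : LinearMap.toMatrix b b (LieModule.toEnd F L U y) = LinkedModules.descMatrix m α :=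
    LinkedModules.toMatrix_eq_descMatrix_iff.mpr hyb
  have hshift : LinearMap.toMatrix b b (LieModule.toEnd F L U v) =
      LinkedModules.shiftMatrix F m :=
    LinkedModules.toMatrix_eq_shiftMatrix_iff.mpr ⟨hvb, hvb0⟩
  refine ⟨b, v, ⟨v, hv, _, hvb1⟩, hdesc, hy.mem_nilRad one_ne_zero hv, hv0, hvy, hshift,
    fun e he he1 => ?_⟩
  have hweight : ∀ δ : LinkedModules.actingEigenvalues y a U,
      (e δ : L) ∈ LinkedModules.adEigenspace y a (δ : F) := fun δ =>
    LinkedModules.mem_adEigenspace.mpr ⟨(e δ).2, he δ⟩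
  have hne : ∀ δ, (e δ : L) ≠ 0 := fun δ h => e.ne_zero δ (Subtype.ext h)
  have hβ : ∀ δ : LinkedModules.actingEigenvalues y a U, ∃ β : F, ∃ j : ℕ, j < m ∧ (δ : F) = j ∧
      LieModule.toEnd F L U (e δ : L) = β • LieModule.toEnd F L U v ^ j := by
    intro δ
    obtain ⟨j, hj, hδj⟩ := hsys.exists_weight_eq (hweight δ) (hne δ)
    obtain ⟨β, hβ⟩ := hy.exists_toEnd_eq_smul_pow (LinkedModules.mem_adEigenspace.mp hv).1
      hsys.cast_inj hyb hvb hj (hδj ▸ hweight δ)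
    exact ⟨β, j, hj, hδj, hβ⟩
  choose β j hj hδj hβ using hβ
  have hβ1 : β ⟨1, ⟨v, hv, _, hvb1⟩⟩ = 1 := by
    have h1 := hβ ⟨1, ⟨v, hv, _, hvb1⟩⟩
    have hj1 : j ⟨1, ⟨v, hv, _, hvb1⟩⟩ = 1 :=
      hsys.cast_inj _ 1 (hj _) hm (by rw [← hδj, Nat.cast_one])
    rw [hj1, pow_one, he1] at h1
    have h2 := LinearMap.congr_fun h1 (b ⟨1, hm⟩)
    rw [LinearMap.smul_apply, LieModule.toEnd_apply_apply] at h2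
    exact smul_left_injective F hvb1 (h2.symm.trans (one_smul F _).symm)
  have hnormal : LinkedModules.IsNormalBasis y (fun δ => (e δ : L)) b α β :=
    ⟨hdesc, fun δ => ⟨j δ, hj δ, hδj δ, by
      rw [hβ, map_smul, ← LinearMap.toMatrix_pow, hshift]⟩⟩
  refine ⟨β, fun δ hδ => hne δ ?_, hβ1, hnormal, fun U' _ _ _ _ m' b' α' β' hβ1' hb' =>
    hnormal.nonempty_equiv_iff hy hm hsys.cast_inj hβ1 hβ1' hb'⟩
  have h1 := hβ δ
  rw [hδ, zero_smul] at h1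
  exact (LieModule.toEnd_eq_zero_iff F L U).mp h1
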